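/- **Setting.** A *Krein space* is an indefinite inner product space $V$ with inner product $\{\cdot,\cdot\}$ (conjugate linear in the first slot) and a fixed orthogonal decomposition $V=V^+\oplus V^-$, with $\{\cdot,\cdot\}$ positive definite on $V^+$ and negative definite on $V^-$, such that $V$ is a Hilbert space after reversing the sign on $V^-$. For $v\in V^\pm$ put $[v]=0$ resp. $1$. An *ON-basis* is an orthonormal basis of this Hilbert space all of whose members lie in $V^+$ or $V^-$. A *linear fermionic classical theory* on a spacetime system (a collection of hypersurfaces $\Sigma$, with orientation reversal $\Sigma\mapsto\overline\Sigma$ and disjoint decompositions, and of regions $M$, with oriented boundary $\partial M$, disjoint unions, slice regions and gluings) assigns * to each $\Sigma$ a complex separable Krein space $L_\Sigma$, with a conjugate linear involution $L_\Sigma\to L_{\overline\Sigma}$, $\phi\mapsto\bar\phi$, such that $\{\bar\phi',\bar\phi\}_{\overline\Sigma}=-\overline{\{\phi',\phi\}_\Sigma}$, and, for each disjoint decomposition $\Sigma=\Sigma_1\cup\dots\cup\Sigma_n$, an isometric isomorphism $L_{\Sigma_1}\oplus\dots\oplus L_{\Sigma_n}\to L_\Sigma$; * to each region $M$ a real vector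 space $L_M$ and a real linear map $r_M:L_M\to L_{\partial M}$ whose image $L_{\tilde M}$ is a real hypermaximal neutral subspace (it equals its own orthogonal companion for $\Re\{\cdot,\cdot\}$) that is compatible with the complex structure: there is a conjugate linear involution $u_M$ of $L_{\partial M}$ with fixed point set $L_{\tilde M}$ that exchanges the positive and the negative part and reverses the sign of $\Re\{\cdot,\cdot\}$; for disjoint unions, $L_{M_1\cup M_2}=L_{M_1}\oplus L_{M_2}$ and $r_{M_1\cup M_2}=r_{M_1}+r_{M_2}$; * to each gluing of a region $M$, with $\partial M=\Sigma_1\cup\Sigma\cup\overline{\Sigma'}$ and $\Sigma'$ a copy of $\Sigma$, to a region $M_1$ along $\Sigma,\overline{\Sigma'}$ (so $\partial M_1=\Sigma_1$) an injective linear map $L_{M_1}\to L_M$ whose image is the equalizer of the two maps $L_M\to L_\Sigma$ obtained from $r_M$ and the projections to $L_\Sigma$ and to $L_{\overline{\Sigma'}}$ (identified with $L_\Sigma$ by the involution), and whose composition with $r_M$ and the projection to $L_{\Sigma_1}$ is $r_{M_1}$. **Quantization.** The fermionic Fock space $\mathcal H_\Sigma=\mathcal F(L_\Sigma)$ is the Krein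 space completion of the space $\mathcal H_\Sigma^\circ$ spanned by the vacuum $\mathbf 1$ and the generating states, the alternating forms $\psi[\xi_1,\dots,\xi_n](\eta_1,\dots,\eta_n)=\frac1{n!}\sum_{\sigma\in S_n}(-1)^{|\sigma|}\prod_i\{\xi_i,\eta_{\sigma(i)}\}$, with $\langle\psi[\eta_1,\dots,\eta_n],\psi[\xi_1,\dots,\xi_n]\rangle=2^n\sum_\sigma(-1)^{|\sigma|}\prod_i\{\xi_i,\eta_{\sigma(i)}\}$, different degrees being orthogonal; its positive (negative) part consists of the forms that are non-zero only on tuples from $L_\Sigma^\pm$ with an even (odd) number of members of $L_\Sigma^-$. On these spans, $\iota_\Sigma:\mathcal H^\circ_\Sigma\to\mathcal H^\circ_{\overline\Sigma}$ is $(\iota_\Sigma\psi)(\bar\xi_1,\dots,\bar\xi_n)=\overline{\psi(\xi_n,\dots,\xi_1)}$; $\tau:\mathcal H^\circ_{\Sigma_1}\otimes\mathcal H^\circ_\Sigma\otimes\mathcal H^\circ_{\overline{\Sigma'}}\to\mathcal H^\circ_{\partial M}$ is the antisymmetrized product of the pulled-back forms, so $\tau(\psi[\phi_1,\dots]\otimes\psi[\xi_1,\dots]\otimes\psi[\eta_1,\dots])=\psi[(\phi_1,0,0),\dots,(0,\xi_1,0),\dots,(0,0,\eta_1),\dots]$;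 and the amplitude $\rho_M:\mathcal H^\circ_{\partial M}\to\mathbb C$ is the linear map with $\rho_M(\mathbf 1)=1$, zero in odd degree, and $$\rho_M(\psi[\xi_1,\dots,\xi_{2n}])=\frac1{n!}\sum_{\sigma\in S_{2n}}(-1)^{|\sigma|}\prod_{j=1}^n\{\hat\xi_{\sigma(j)},\hat\xi_{\sigma(2n+1-j)}\},$$ where $\hat\xi=\xi^{R}-\mathrm i\,\xi^{I}$ in the complexification for $\xi=\xi^R+J\xi^I$ with $\xi^R,\xi^I\in L_{\tilde M}$ and $J$ the complex structure of $L_{\partial M}$, and $\{\cdot,\cdot\}$ is extended complex bilinearly. Let $\{L_{\Sigma,\alpha}\}_{\alpha\in A}$ be the family of all finite-dimensional complex subspaces of $L_\Sigma$, directed by inclusion, and let $P_\alpha$ be the orthogonal projector of $\mathcal H_\Sigma$ onto the finite-dimensional Fock subspace $\mathcal F(L_{\Sigma,\alpha})\subseteq\mathcal H_\Sigma^\circ$, the span of the vacuum and of the $\psi[\xi_1,\dots,\xi_n]$ with all $\xi_i\in L_{\Sigma,\alpha}$. **Theorem (renormalized gluing).** Let $M_1$ be a region obtained by gluing a region $M$,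 $\partial M=\Sigma_1\cup\Sigma\cup\overline{\Sigma'}$, to itself along $\Sigma,\overline{\Sigma'}$. No integrability condition is assumed. Then: 1. For every $\alpha\in A$ and every ON-basis $\{\zeta_i\}_{i\in I}$ of $\mathcal H_\Sigma$ the sum $$c_\alpha=\sum_{i\in I}(-1)^{[\zeta_i]}\rho_M\big(\tau(\mathbf 1\otimes P_\alpha\zeta_i\otimes\iota_\Sigma(P_\alpha\zeta_i))\big)$$ converges absolutely, and its value does not depend on the ON-basis. 2. For every $\psi\in\mathcal H^\circ_{\partial M_1}$, every $\alpha$ and every ON-basis $\{\zeta_i\}_{i\in I}$ of $\mathcal H_\Sigma$ the sum $\sum_{i\in I}(-1)^{[\zeta_i]}\rho_M(\tau(\psi\otimes P_\alpha\zeta_i\otimes\iota_\Sigma(P_\alpha\zeta_i)))$ converges absolutely, and $$\lim_{\alpha}\Big(\rho_{M_1}(\psi)\,c_\alpha-\sum_{i\in I}(-1)^{[\zeta_i]}\rho_M\big(\tau(\psi\otimes P_\alpha\zeta_i\otimes\iota_\Sigma(P_\alpha\zeta_i))\big)\Big)=0 .$$ 3. The difference is eventually exactly zero: for every $\psi\in\mathcal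 H^\circ_{\partial M_1}$ there is $\beta\in A$ such that for all $\gamma\ge\beta$ and all ON-bases $\{\zeta_i\}$ of $\mathcal H_\Sigma$ it vanishes for $\alpha=\gamma$. -/

import Mathlib

open ComplexConjugate Filter Topology
open scoped Nat

universe u v w z

set_option linter.unusedSectionVars false
set_option linter.checkUnivs false

noncomputable section

/-! Krein spaces -/

/-- A (strict) Krein space: the canonical decomposition `V = V⁺ ⊕ V⁻` is encoded by the fundamental
symmetry `sym`, which is `1` on `V⁺` and `-1` on `V⁻`. The ambient `InnerProductSpace` structure is
the positive definite one of the Hilbert space `V⁺ ⊕ (V⁻ with the opposite inner product)`;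
completeness is asked for separately through `CompleteSpace V`. -/
class KreinSpace (V : Type*) [NormedAddCommGroup V] [InnerProductSpace ℂ V] where
  sym : V →ₗᵢ[ℂ] V
  sym_sym : ∀ x, sym (sym x) = x

namespace KreinSpace

variable {V : Type*} [NormedAddCommGroup V] [InnerProductSpace ℂ V] [KreinSpace V]

/-- The indefinite inner product `{x, y}`, conjugate linear in `x`. -/
def kip (x y : V) : ℂ := inner ℂ (sym x) y

variable (V) in
/-- The positive part `V⁺`. -/
def pos : Submodule ℂ V := LinearMap.ker ((sym : V →ₗᵢ[ℂ] V).toLinearMap - LinearMap.id)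

variable (V) in
/-- The negative part `V⁻`. -/
def neg : Submodule ℂ V := LinearMap.ker ((sym : V →ₗᵢ[ℂ] V).toLinearMap + LinearMap.id)

theorem mem_pos {x : V} : x ∈ pos V ↔ sym x = x := by
  simp [pos, sub_eq_zero]

theorem mem_neg {x : V} : x ∈ neg V ↔ sym x = -x := by
  simp [neg, add_eq_zero_iff_eq_neg]

open Classical in
/-- The signature `[v]` of a vector: `0` on `V⁺` and `1` on `V⁻`. -/
def sig (v : V) : ℕ := if v ∈ pos V then 0 else 1

/-- An ON-basis of a Krein space: an orthonormal basis of the associated Hilbert space, each member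
of which lies in the positive or in the negative part. -/
structure IsONBasis {I : Type*} (ζ : I → V) : Prop where
  orthonormal : Orthonormal ℂ ζ
  dense : Dense (Submodule.span ℂ (Set.range ζ) : Set V)
  mem : ∀ i, ζ i ∈ pos V ∨ ζ i ∈ neg V

/-- The orthogonal companion of a real subspace for the real part of the inner product is the
subspace itself. -/
def IsRealHypermaximalNeutral (W : Submodule ℝ V) : Prop :=
  ∀ x, x ∈ W ↔ ∀ w ∈ W, (kip x w).re = 0

/-- `u` is a conjugate linear involutive adapted real anti-isometry with fixed point set `W`. -/
structure IsConjugation (W : Submodule ℝ V) (u : V →ₛₗ[starRingEnd ℂ] V) : Prop where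
  involutive : ∀ x, u (u x) = x
  map_pos : ∀ x ∈ pos V, u x ∈ neg V
  map_neg : ∀ x ∈ neg V, u x ∈ pos V
  anti : ∀ x y, (kip (u x) (u y)).re = -(kip x y).re
  mem_iff : ∀ x, x ∈ W ↔ u x = x

/-- The real subspace `W` is compatible with the complex structure: the involutive adapted real
anti-isometry with fixed point set `W` is conjugate linear. -/
def IsCompatible (W : Submodule ℝ V) : Prop := ∃ u : V →ₛₗ[starRingEnd ℂ] V, IsConjugation W u

end KreinSpace

open KreinSpace

/-- The finite-dimensional complex subspaces of `V`, ordered by inclusion. -/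
def FinSub (V : Type*) [NormedAddCommGroup V] [InnerProductSpace ℂ V] : Type _ :=
  {K : Submodule ℂ V // FiniteDimensional ℂ K}

namespace FinSub

variable {V : Type*} [NormedAddCommGroup V] [InnerProductSpace ℂ V]

instance : PartialOrder (FinSub V) := inferInstanceAs (PartialOrder (Subtype _))

instance : Inhabited (FinSub V) := ⟨⟨⊥, inferInstance⟩⟩

instance : IsDirectedOrder (FinSub V) where
  directed K K' := by
    have h1 := K.2
    have h2 := K'.2
    exact ⟨⟨K.1 ⊔ K'.1, inferInstance⟩, (le_sup_left : K.1 ≤ K.1 ⊔ K'.1),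
      (le_sup_right : K'.1 ≤ K.1 ⊔ K'.1)⟩

end FinSub

/-! Conjugate linear functoriality of the exterior algebra -/

/-- The ring `A` with the conjugate scalar multiplication. -/
def ConjAlg (A : Type*) : Type _ := A

instance (A : Type*) [Ring A] : Ring (ConjAlg A) := inferInstanceAs (Ring A)

instance (A : Type*) [Ring A] [Algebra ℂ A] : Algebra ℂ (ConjAlg A) :=
  fast_instance% (Algebra.compHom A (starRingEnd ℂ) : Algebra ℂ A)

section
variable {V W : Type*} [AddCommGroup V] [Module ℂ V] [AddCommGroup W] [Module ℂ W]

/-- Auxiliary version of `extConj` with values in `ConjAlg`. -/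
def extConjAlgHom (f : V →ₛₗ[starRingEnd ℂ] W) :
    ExteriorAlgebra ℂ V →ₐ[ℂ] ConjAlg (ExteriorAlgebra ℂ W) :=
  ExteriorAlgebra.lift ℂ
    ⟨{ toFun := fun v => (ExteriorAlgebra.ι ℂ (f v) : ExteriorAlgebra ℂ W)
       map_add' := fun x y => by
         show ExteriorAlgebra.ι ℂ (f (x + y)) = ExteriorAlgebra.ι ℂ (f x) + ExteriorAlgebra.ι ℂ (f y)
         rw [map_add, map_add]
       map_smul' := fun c x => by
         show ExteriorAlgebra.ι ℂ (f (c • x)) = (starRingEnd ℂ c) • ExteriorAlgebra.ι ℂ (f x)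
         rw [map_smulₛₗ, map_smul] },
      fun v => ExteriorAlgebra.ι_sq_zero (f v)⟩

/-- The conjugate linear multiplicative extension `v₁ ∧ ⋯ ∧ vₙ ↦ f v₁ ∧ ⋯ ∧ f vₙ`. -/
def extConj (f : V →ₛₗ[starRingEnd ℂ] W) :
    ExteriorAlgebra ℂ V →ₛₗ[starRingEnd ℂ] ExteriorAlgebra ℂ W where
  toFun x := extConjAlgHom f x
  map_add' x y := map_add (extConjAlgHom f) x y
  map_smul' c x := map_smul (extConjAlgHom f) c x

theorem extConj_mul (f : V →ₛₗ[starRingEnd ℂ] W) (x y : ExteriorAlgebra ℂ V) :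
    extConj f (x * y) = extConj f x * extConj f y :=
  map_mul (extConjAlgHom f) x y

theorem extConj_one (f : V →ₛₗ[starRingEnd ℂ] W) : extConj f 1 = 1 :=
  (map_one (extConjAlgHom f) :)

theorem extConj_ι (f : V →ₛₗ[starRingEnd ℂ] W) (v : V) :
    extConj f (ExteriorAlgebra.ι ℂ v) = ExteriorAlgebra.ι ℂ (f v) :=
  (ExteriorAlgebra.lift_ι_apply (A := ConjAlg (ExteriorAlgebra ℂ W)) ℂ _ _ v :)

theorem extConj_ιMulti (f : V →ₛₗ[starRingEnd ℂ] W) {n : ℕ} (v : Fin n → V) :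
    extConj f (ExteriorAlgebra.ιMulti ℂ n v) = ExteriorAlgebra.ιMulti ℂ n (fun i => f (v i)) := by
  induction n with
  | zero => simp [ExteriorAlgebra.ιMulti_apply, extConj_one]
  | succ n ih =>
    rw [ExteriorAlgebra.ιMulti_succ_apply, extConj_mul, extConj_ι, ih,
      ExteriorAlgebra.ιMulti_succ_apply]
    rfl
end

section

variable {L : Type*} [NormedAddCommGroup L] [InnerProductSpace ℂ L]

/-! The algebraic Fock space -/

variable (L) in
/-- The algebraic fermionic Fock space: the exterior algebra over the dual, whose elements are read
as finite sums of alternating multilinear forms on `L` (see `toForm`). It is the span of the vacuum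
and of the generating states (see `span_cs`), and is dense in the Fock space. -/
def FockAlg : Type _ := ExteriorAlgebra ℂ (StrongDual ℂ L)

instance : Ring (FockAlg L) := inferInstanceAs (Ring (ExteriorAlgebra ℂ (StrongDual ℂ L)))

instance : Algebra ℂ (FockAlg L) := inferInstanceAs (Algebra ℂ (ExteriorAlgebra ℂ (StrongDual ℂ L)))

namespace FockAlg

/-- The alternating `n`-form on `L` given by an element of the exterior algebra over the dual,
`(f₁ ∧ ⋯ ∧ fₙ)(ξ₁, …, ξₙ) = 1/n! ∑_σ sgn σ ∏ᵢ fᵢ(ξ_σ(i))`. -/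
def toForm (n : ℕ) : ExteriorAlgebra ℂ (StrongDual ℂ L) →ₗ[ℂ] (L [⋀^Fin n]→ₗ[ℂ] ℂ) :=
  ExteriorAlgebra.liftAlternating (Pi.single n
    ((((n ! : ℂ)⁻¹ • (exteriorPower.alternatingMapLinearEquiv
      (R := ℂ) (M := L) (N := ℂ) (n := n)).symm.toLinearMap) ∘ₗ
        exteriorPower.pairingDual ℂ L n).compAlternatingMap
      ((exteriorPower.ιMulti ℂ n).compLinearMap (ContinuousLinearMap.coeLM ℂ))))

theorem toForm_ιMulti {n : ℕ} (f : Fin n → StrongDual ℂ L) (ξ : Fin n → L) :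
    toForm n (ExteriorAlgebra.ιMulti ℂ n f) ξ = (n ! : ℂ)⁻¹ *
      ∑ σ : Equiv.Perm (Fin n), ((Equiv.Perm.sign σ : ℤ) : ℂ) * ∏ i, f i (ξ (σ i)) := by
  simp [toForm, exteriorPower.alternatingMapLinearEquiv_symm_apply,
    exteriorPower.pairingDual_ιMulti_ιMulti, Matrix.det_apply']

theorem toForm_ιMulti_ne {n m : ℕ} (h : m ≠ n) (f : Fin n → StrongDual ℂ L) :
    toForm m (ExteriorAlgebra.ιMulti ℂ n f) = 0 := by
  simp [toForm, Pi.single_eq_of_ne h.symm]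

/-- The complex bilinear pairing of forms with exterior products of vectors, with the
normalization `(ψ, ξ₁ ∧ ⋯ ∧ ξₙ) ↦ 2ⁿ n! ψ(ξ₁, …, ξₙ)`. -/
def pairing : ExteriorAlgebra ℂ (StrongDual ℂ L) →ₗ[ℂ] ExteriorAlgebra ℂ L →ₗ[ℂ] ℂ :=
  ExteriorAlgebra.liftAlternating (R := ℂ) (M := L) (N := ℂ) ∘ₗ
    LinearMap.pi fun n => ((2 : ℂ) ^ n * n !) • toForm n

theorem pairing_ιMulti {n : ℕ} (f : Fin n → StrongDual ℂ L) (ξ : Fin n → L) :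
    pairing (ExteriorAlgebra.ιMulti ℂ n f) (ExteriorAlgebra.ιMulti ℂ n ξ) =
      2 ^ n * (Matrix.of fun i j => f j (ξ i)).det := by
  have h : (n ! : ℂ) ≠ 0 := by exact_mod_cast n.factorial_ne_zero
  simp [pairing, toForm_ιMulti, Matrix.det_apply', mul_assoc, h]

theorem pairing_ιMulti_ne {n m : ℕ} (h : m ≠ n) (f : Fin n → StrongDual ℂ L) (ξ : Fin m → L) :
    pairing (ExteriorAlgebra.ιMulti ℂ n f) (ExteriorAlgebra.ιMulti ℂ m ξ) = 0 := by
  simp [pairing, toForm_ιMulti_ne h]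

theorem span_induction {p : ExteriorAlgebra ℂ (StrongDual ℂ L) → Prop} 
    (h : ∀ n (f : Fin n → StrongDual ℂ L), p (ExteriorAlgebra.ιMulti ℂ n f))
    (h0 : p 0) (hadd : ∀ x y, p x → p y → p (x + y)) (hsmul : ∀ (c : ℂ) x, p x → p (c • x)) (x) :
    p x := by
  have hx : x ∈ Submodule.span ℂ (Set.range fun x : (Σ n, Fin n → StrongDual ℂ L) =>
      ExteriorAlgebra.ιMulti ℂ x.1 x.2) := by
    rw [ExteriorAlgebra.ιMulti_span]; trivial
  induction hx using Submodule.span_induction with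
  | mem x h' => obtain ⟨⟨n, f⟩, rfl⟩ := h'; exact h n f
  | zero => exact h0
  | add x y _ _ hx hy => exact hadd x y hx hy
  | smul c x _ hx => exact hsmul c x hx

variable [CompleteSpace L]

variable (L) in
/-- The vector representing a linear form in the Hilbert space `L`. -/
def rieszInv : StrongDual ℂ L →ₛₗ[starRingEnd ℂ] L :=
  ((InnerProductSpace.toDual ℂ L).symm.toLinearEquiv : StrongDual ℂ L →ₛₗ[starRingEnd ℂ] L)

theorem inner_rieszInv (f : StrongDual ℂ L) (x : L) : inner ℂ (rieszInv L f) x = f x := by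
  simp [rieszInv]

theorem rieszInv_toDual (x : L) : rieszInv L (InnerProductSpace.toDual ℂ L x) = x := by
  simp [rieszInv]

/-- The positive definite inner product: on generators of degree `n` it is
`2ⁿ det (gⱼ (rieszInv fᵢ))`, and different degrees are orthogonal. -/
def ip (x y : ExteriorAlgebra ℂ (StrongDual ℂ L)) : ℂ := pairing y (extConj (rieszInv L) x)

theorem ip_add_left (x y z : ExteriorAlgebra ℂ (StrongDual ℂ L)) : ip (x + y) z = ip x z + ip y z := by
  simp [ip]

theorem ip_smul_left (c : ℂ) (x z : ExteriorAlgebra ℂ (StrongDual ℂ L)) :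
    ip (c • x) z = conj c * ip x z := by
  simp [ip]

theorem ip_add_right (x y z : ExteriorAlgebra ℂ (StrongDual ℂ L)) : ip x (y + z) = ip x y + ip x z := by
  simp [ip]

theorem ip_smul_right (c : ℂ) (x z : ExteriorAlgebra ℂ (StrongDual ℂ L)) :
    ip x (c • z) = c * ip x z := by
  simp [ip]

theorem ip_ιMulti {n : ℕ} (f g : Fin n → StrongDual ℂ L) :
    ip (ExteriorAlgebra.ιMulti ℂ n f) (ExteriorAlgebra.ιMulti ℂ n g) =
      2 ^ n * (Matrix.of fun i j => g j (rieszInv L (f i))).det := by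
  rw [ip, extConj_ιMulti, pairing_ιMulti]

theorem ip_ιMulti_ne {n m : ℕ} (h : m ≠ n) (f : Fin m → StrongDual ℂ L)
    (g : Fin n → StrongDual ℂ L) :
    ip (ExteriorAlgebra.ιMulti ℂ m f) (ExteriorAlgebra.ιMulti ℂ n g) = 0 := by
  rw [ip, extConj_ιMulti, pairing_ιMulti_ne h]

theorem ip_conj (x y : ExteriorAlgebra ℂ (StrongDual ℂ L)) : conj (ip y x) = ip x y := by
  induction x using span_induction with
  | h n f =>
    induction y using span_induction with
    | h m g =>
      by_cases hmn : m = n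
      · subst hmn
        rw [ip_ιMulti, ip_ιMulti, map_mul, map_pow, RingHom.map_det, ← Matrix.det_transpose]
        simp only [map_ofNat]
        congr 2
        ext i j
        simp [← inner_rieszInv]
      · rw [ip_ιMulti_ne hmn, ip_ιMulti_ne (Ne.symm hmn), map_zero]
    | h0 => simp [ip]
    | hadd x y hx hy => rw [ip_add_left, ip_add_right, map_add, hx, hy]
    | hsmul c x hx => rw [ip_smul_left, ip_smul_right, map_mul, hx, Complex.conj_conj]
  | h0 => simp [ip]
  | hadd x y hx hy => rw [ip_add_left, ip_add_right, map_add, hx, hy]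
  | hsmul c x hx => rw [ip_smul_left, ip_smul_right, map_mul, hx]

theorem exists_adjoin (x : ExteriorAlgebra ℂ (StrongDual ℂ L)) : ∃ K : Submodule ℂ L,
    FiniteDimensional ℂ K ∧ x ∈ Algebra.adjoin ℂ
      ((fun ξ => ExteriorAlgebra.ι ℂ (InnerProductSpace.toDual ℂ L ξ)) '' (K : Set L)) := by
  induction x using ExteriorAlgebra.induction with
  | algebraMap r => exact ⟨⊥, inferInstance, Subalgebra.algebraMap_mem _ _⟩
  | ι f =>
    refine ⟨Submodule.span ℂ {rieszInv L f}, inferInstance, Algebra.subset_adjoin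
      ⟨rieszInv L f, Submodule.mem_span_singleton_self _, ?_⟩⟩
    simp [rieszInv]
  | mul a b ha hb =>
    obtain ⟨K, _, hK⟩ := ha
    obtain ⟨K', _, hK'⟩ := hb
    refine ⟨K ⊔ K', inferInstance, mul_mem
      (Algebra.adjoin_mono (Set.image_mono (SetLike.coe_subset_coe.2 le_sup_left)) hK)
      (Algebra.adjoin_mono (Set.image_mono (SetLike.coe_subset_coe.2 le_sup_right)) hK')⟩
  | add a b ha hb =>
    obtain ⟨K, _, hK⟩ := ha
    obtain ⟨K', _, hK'⟩ := hb
    refine ⟨K ⊔ K', inferInstance, add_mem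
      (Algebra.adjoin_mono (Set.image_mono (SetLike.coe_subset_coe.2 le_sup_left)) hK)
      (Algebra.adjoin_mono (Set.image_mono (SetLike.coe_subset_coe.2 le_sup_right)) hK')⟩

theorem exists_repr (x : ExteriorAlgebra ℂ (StrongDual ℂ L)) :
    ∃ (k : ℕ) (e : Fin k → L) (c : Finset (Fin k) → ℂ), Orthonormal ℂ e ∧
      x = ∑ s, c s • ExteriorAlgebra.ιMulti ℂ s.card
        (fun i => InnerProductSpace.toDual ℂ L (e (s.orderEmbOfFin rfl i))) := by
  obtain ⟨K, _, hx⟩ := exists_adjoin x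
  let e := stdOrthonormalBasis ℂ K
  let Φ : (Fin (Module.finrank ℂ K) → ℂ) →ₗ[ℂ] StrongDual ℂ L :=
    Fintype.linearCombination ℂ (fun i => InnerProductSpace.toDual ℂ L (e i))
  have hx' : x ∈ (ExteriorAlgebra.map Φ).range := by
    refine (Algebra.adjoin_le ?_ : Algebra.adjoin ℂ _ ≤ _) hx
    rintro _ ⟨ξ, hξ, rfl⟩
    refine ⟨ExteriorAlgebra.ι ℂ (fun i => conj (e.repr ⟨ξ, hξ⟩ i)), ?_⟩
    change ExteriorAlgebra.map Φ _ = _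
    rw [ExteriorAlgebra.map_apply_ι]
    congr 1
    have := congrArg (fun y : K => InnerProductSpace.toDual ℂ L y) (e.sum_repr ⟨ξ, hξ⟩)
    simp only [Submodule.coe_sum, Submodule.coe_smul, map_sum, map_smulₛₗ] at this
    rw [← this]
    simp [Φ, Fintype.linearCombination_apply]
  obtain ⟨y, hy⟩ := hx'
  let b := (Pi.basisFun ℂ (Fin (Module.finrank ℂ K))).ExteriorAlgebra
  refine ⟨_, fun i => (e i : L), fun s => b.repr y s, ?_, ?_⟩
  · exact e.orthonormal.comp_linearIsometry K.subtypeₗᵢ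
  · rw [← hy, ← b.sum_repr y]
    change ExteriorAlgebra.map Φ _ = _
    rw [map_sum]
    refine Finset.sum_congr rfl fun s _ => ?_
    rw [map_smul, b.sum_repr y]
    congr 1
    have hs : b s = ExteriorAlgebra.ιMulti_family ℂ s.card (Pi.basisFun ℂ _)
       (Set.powersetCard.ofCard rfl) := ExteriorAlgebra.basis_apply_ofCard _ rfl
    rw [hs, ExteriorAlgebra.ιMulti_family, ExteriorAlgebra.map_apply_ιMulti]
    congr 1
    ext i : 1
    simp [Φ]
    rfl

theorem ip_repr {k : ℕ} {e : Fin k → L} (he : Orthonormal ℂ e) (s t : Finset (Fin k)) :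
    ip (ExteriorAlgebra.ιMulti ℂ s.card
        (fun i => InnerProductSpace.toDual ℂ L (e (s.orderEmbOfFin rfl i))))
      (ExteriorAlgebra.ιMulti ℂ t.card
        (fun i => InnerProductSpace.toDual ℂ L (e (t.orderEmbOfFin rfl i)))) =
      if s = t then 2 ^ s.card else 0 := by
  have key : ∀ (m : ℕ) (a : Fin m → Fin k), Function.Injective a → m = t.card →
      Finset.univ.image a ≠ t → ip (ExteriorAlgebra.ιMulti ℂ m
        (fun i => InnerProductSpace.toDual ℂ L (e (a i))))
      (ExteriorAlgebra.ιMulti ℂ t.card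
        (fun i => InnerProductSpace.toDual ℂ L (e (t.orderEmbOfFin rfl i)))) = 0 := by
    rintro m a ha rfl hne
    have : ∃ j, t.orderEmbOfFin rfl j ∉ Finset.univ.image a := by
      by_contra! hcon
      refine hne (Finset.eq_of_subset_of_card_le (fun x hx => ?_) ?_).symm
      · have hx' : x ∈ Set.range (t.orderEmbOfFin rfl) := by
          rw [Finset.range_orderEmbOfFin]; exact hx
        obtain ⟨j, rfl⟩ := hx'
        exact hcon j
      · rw [Finset.card_image_of_injective _ ha]; simp
    obtain ⟨j, hj⟩ := this
    rw [ip_ιMulti, Matrix.det_eq_zero_of_column_eq_zero j, mul_zero]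
    intro i
    simp only [Matrix.of_apply, rieszInv_toDual, InnerProductSpace.toDual_apply_apply]
    refine he.2 fun h => hj ?_
    rw [h]
    exact Finset.mem_image_of_mem a (Finset.mem_univ i)
  split_ifs with h
  · subst h
    rw [ip_ιMulti]
    have : (Matrix.of fun i j => (InnerProductSpace.toDual ℂ L) (e ((s.orderEmbOfFin rfl) j))
        (rieszInv L ((InnerProductSpace.toDual ℂ L) (e ((s.orderEmbOfFin rfl) i))))) = 1 := by
      ext i j
      simp only [Matrix.of_apply, rieszInv_toDual, InnerProductSpace.toDual_apply_apply]
      rw [orthonormal_iff_ite.1 he, Matrix.one_apply]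
      simp [eq_comm]
    rw [this, Matrix.det_one, mul_one]
  · by_cases hst : s.card = t.card
    · refine key _ _ (s.orderEmbOfFin rfl).injective hst fun h' => h ?_
      rw [← h', Finset.image_orderEmbOfFin_univ]
    · exact ip_ιMulti_ne hst _ _

theorem ip_self (x : ExteriorAlgebra ℂ (StrongDual ℂ L)) : 
    0 ≤ (ip x x).re ∧ (ip x x = 0 → x = 0) := by
  obtain ⟨k, e, c, he, rfl⟩ := exists_repr x
  set b : Finset (Fin k) → ExteriorAlgebra ℂ (StrongDual ℂ L) := fun s => ExteriorAlgebra.ιMulti ℂ s.card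
        (fun i => InnerProductSpace.toDual ℂ L (e (s.orderEmbOfFin rfl i))) with hb
  have h1 : ip (∑ s, c s • b s) (∑ s, c s • b s) = ((∑ s, ‖c s‖ ^ 2 * 2 ^ s.card : ℝ) : ℂ) := by
    have hl (z) : ip (∑ s, c s • b s) z = ∑ s, conj (c s) * ip (b s) z := by
      simp [ip]
    have hr (z) : ip z (∑ s, c s • b s) = ∑ s, c s * ip z (b s) := by
      simp [ip]
    have ho (s t) : ip (b s) (b t) = if s = t then 2 ^ s.card else 0 := ip_repr he s t
    rw [hl]
    simp only [hr, ho, mul_ite, mul_zero, Finset.sum_ite_eq, Finset.mem_univ, if_true]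
    push_cast
    refine Finset.sum_congr rfl fun s _ => ?_
    rw [← mul_assoc, Complex.conj_mul']
  rw [h1]
  refine ⟨?_, fun h => ?_⟩
  · rw [Complex.ofReal_re]; positivity
  · rw [Complex.ofReal_eq_zero, Finset.sum_eq_zero_iff_of_nonneg (fun _ _ => by positivity)] at h
    refine Finset.sum_eq_zero fun s _ => ?_
    have := h s (Finset.mem_univ _)
    have : c s = 0 := by simpa using this
    rw [this, zero_smul]

instance core : InnerProductSpace.Core ℂ (FockAlg L) where
  inner := ip
  conj_inner_symm := ip_conj
  add_left := ip_add_left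
  smul_left x y c := ip_smul_left c x y
  re_inner_nonneg x := (ip_self x).1
  definite x := (ip_self x).2

instance : NormedAddCommGroup (FockAlg L) :=
  InnerProductSpace.Core.toNormedAddCommGroup (𝕜 := ℂ)

instance : InnerProductSpace ℂ (FockAlg L) := InnerProductSpace.ofCore _
end FockAlg

/-! Fock space -/

variable [CompleteSpace L]

variable (L) in
/-- The fermionic Fock space `𝓕(L)`: the Hilbert space completion of the algebraic Fock space. -/
abbrev FockSpace : Type _ := UniformSpace.Completion (FockAlg L)

variable [KreinSpace L]

variable (L) in
/-- The map `ξ ↦ {ξ, ·}`. -/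
def kdual : L →ₛₗ[starRingEnd ℂ] StrongDual ℂ L :=
  ((InnerProductSpace.toDual ℂ L).toLinearEquiv : L →ₛₗ[starRingEnd ℂ] StrongDual ℂ L).comp
    (sym : L →ₗᵢ[ℂ] L).toLinearMap

theorem kdual_apply (ξ η : L) : kdual L ξ η = kip ξ η := by
  simp [kdual, kip]

variable (L) in
/-- The inverse of `kdual`: the vector `ξ` with `f = {ξ, ·}`. -/
def kdualInv : StrongDual ℂ L →ₛₗ[starRingEnd ℂ] L :=
  (sym : L →ₗᵢ[ℂ] L).toLinearMap.comp (FockAlg.rieszInv L)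

theorem kdual_kdualInv (f : StrongDual ℂ L) : kdual L (kdualInv L f) = f := by
  ext x
  simp [kdual, kdualInv, sym_sym, FockAlg.rieszInv]

theorem kdualInv_kdual (ξ : L) : kdualInv L (kdual L ξ) = ξ := by
  simp [kdual, kdualInv, sym_sym, FockAlg.rieszInv]

namespace FockAlg

/-- The generating state `ψ[ξ₁, …, ξₙ]`. -/
def cs {n : ℕ} (ξ : Fin n → L) : FockAlg L :=
  ExteriorAlgebra.ιMulti ℂ n fun i => kdual L (ξ i)

theorem span_cs :
    Submodule.span ℂ {ψ : FockAlg L | ∃ (n : ℕ) (ξ : Fin n → L), ψ = cs ξ} = ⊤ := by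
  refine Submodule.eq_top_iff'.2 fun x => ?_
  refine span_induction (p := fun x => x ∈ Submodule.span ℂ
    {ψ : FockAlg L | ∃ (n : ℕ) (ξ : Fin n → L), ψ = cs ξ}) (fun n f => ?_) (zero_mem _)
    (fun x y => add_mem) (fun c x => Submodule.smul_mem _ c) x
  refine Submodule.subset_span ⟨n, fun i => kdualInv L (f i), ?_⟩
  simp only [cs, kdual_kdualInv]
  rfl

theorem toForm_cs {n : ℕ} (ξ η : Fin n → L) : toForm n (cs ξ) η = (n ! : ℂ)⁻¹ *
    ∑ σ : Equiv.Perm (Fin n), ((Equiv.Perm.sign σ : ℤ) : ℂ) * ∏ i, kip (ξ i) (η (σ i)) := by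
  refine (toForm_ιMulti _ _).trans ?_
  simp only [kdual_apply]

variable (L) in
/-- The map `f ↦ f ∘ sym`. -/
def precompSym : StrongDual ℂ L →ₗ[ℂ] StrongDual ℂ L where
  toFun f := f.comp (sym : L →ₗᵢ[ℂ] L).toContinuousLinearMap
  map_add' _ _ := rfl
  map_smul' _ _ := rfl

theorem rieszInv_precompSym (f : StrongDual ℂ L) :
    rieszInv L (precompSym L f) = sym (rieszInv L f) := by
  refine ext_inner_right ℂ fun v => ?_
  have h := (sym : L →ₗᵢ[ℂ] L).inner_map_map (rieszInv L f) (sym v)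
  rw [sym_sym] at h
  rw [inner_rieszInv, h, inner_rieszInv]
  rfl

theorem precompSym_apply (f : StrongDual ℂ L) (v : L) : precompSym L f v = f (sym v) := rfl

theorem map_precompSym_twice (x : ExteriorAlgebra ℂ (StrongDual ℂ L)) :
    ExteriorAlgebra.map (precompSym L) (ExteriorAlgebra.map (precompSym L) x) = x := by
  have : precompSym L ∘ₗ precompSym L = LinearMap.id := by
    ext f v
    simp [precompSym_apply, sym_sym]
  have h := ExteriorAlgebra.map_comp_map (precompSym L) (precompSym L)
  rw [this, ExteriorAlgebra.map_id] at h
  exact DFunLike.congr_fun h x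

theorem ip_map_precompSym (x y : ExteriorAlgebra ℂ (StrongDual ℂ L)) :
    ip (ExteriorAlgebra.map (precompSym L) x) (ExteriorAlgebra.map (precompSym L) y) = ip x y := by
  induction x using span_induction with
  | h n f =>
    induction y using span_induction with
    | h m g =>
      rw [ExteriorAlgebra.map_apply_ιMulti, ExteriorAlgebra.map_apply_ιMulti]
      by_cases hmn : m = n
      · subst hmn
        rw [ip_ιMulti, ip_ιMulti]
        simp [rieszInv_precompSym, precompSym_apply, sym_sym]
      · rw [ip_ιMulti_ne (Ne.symm hmn), ip_ιMulti_ne (Ne.symm hmn)]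
    | h0 => simp [ip]
    | hadd y z hy hz => rw [map_add, ip_add_right, ip_add_right, hy, hz]
    | hsmul c y hy => rw [map_smul, ip_smul_right, ip_smul_right, hy]
  | h0 => simp [ip]
  | hadd x z hx hz => rw [map_add, ip_add_left, ip_add_left, hx, hz]
  | hsmul c x hx => rw [map_smul, ip_smul_left, ip_smul_left, hx]

variable (L) in
/-- The grading `F⁺ ⊕ F⁻` of the algebraic Fock space:
`(Γψ)(ξ₁, …, ξₙ) = ψ(sym ξ₁, …, sym ξₙ)`. -/
def gammaLin : FockAlg L →ₗ[ℂ] FockAlg L := (ExteriorAlgebra.map (precompSym L)).toLinearMap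

variable (L) in
/-- `gammaLin` as a linear isometry. -/
def gamma : FockAlg L →ₗᵢ[ℂ] FockAlg L where
  toLinearMap := gammaLin L
  norm_map' x := by
    rw [@norm_eq_sqrt_re_inner ℂ, @norm_eq_sqrt_re_inner ℂ]
    exact congrArg (fun z : ℂ => √z.re) (ip_map_precompSym x x)

end FockAlg

variable (L) in
/-- The extension of `Γ` to the Fock space. -/
def FockSpace.gamma : FockSpace L →L[ℂ] FockSpace L :=
  (FockAlg.gamma L).toContinuousLinearMap.completion

theorem FockSpace.gamma_coe (x : FockAlg L) :
    FockSpace.gamma L (x : FockSpace L) = (FockAlg.gamma L x : FockSpace L) :=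
  ContinuousLinearMap.completion_apply_coe _ _

/-- The Krein space structure of the Fock space: `Γ` is `1` (`-1`) on the forms which are non-zero
only on tuples with an even (odd) number of arguments in `L⁻`. -/
instance : KreinSpace (FockSpace L) where
  sym :=
    { toLinearMap := (FockSpace.gamma L).toLinearMap
      norm_map' := fun x => by
        change ‖FockSpace.gamma L x‖ = ‖x‖
        induction x using UniformSpace.Completion.induction_on with
        | hp => exact isClosed_eq (by fun_prop) (by fun_prop)
        | ih x =>
          rw [FockSpace.gamma_coe, UniformSpace.Completion.norm_coe,
            UniformSpace.Completion.norm_coe, LinearIsometry.norm_map] }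
  sym_sym x := by
    change FockSpace.gamma L (FockSpace.gamma L x) = x
    induction x using UniformSpace.Completion.induction_on with
    | hp => exact isClosed_eq (by fun_prop) (by fun_prop)
    | ih x =>
      rw [FockSpace.gamma_coe, FockSpace.gamma_coe]
      exact congrArg _ (FockAlg.map_precompSym_twice x)

/-- The indefinite inner product of generating states. -/
theorem FockSpace.kip_cs {n : ℕ} (η ξ : Fin n → L) :
    kip (FockAlg.cs η : FockSpace L) (FockAlg.cs ξ : FockSpace L) = 2 ^ n *
      ∑ σ : Equiv.Perm (Fin n), ((Equiv.Perm.sign σ : ℤ) : ℂ) * ∏ i, kip (ξ i) (η (σ i)) := by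
  have h : kip (FockAlg.cs η : FockSpace L) (FockAlg.cs ξ : FockSpace L) =
      FockAlg.ip (ExteriorAlgebra.map (FockAlg.precompSym L) (FockAlg.cs η)) (FockAlg.cs ξ) := by
    refine Eq.trans ?_ (UniformSpace.Completion.inner_coe (𝕜 := ℂ)
      (FockAlg.gamma L (FockAlg.cs η)) (FockAlg.cs ξ))
    rw [← FockSpace.gamma_coe]
    rfl
  rw [h, FockAlg.cs, FockAlg.cs, ExteriorAlgebra.map_apply_ιMulti, FockAlg.ip_ιMulti, Matrix.det_apply']
  congr 1
  refine Finset.sum_congr rfl fun σ _ => ?_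
  simp [FockAlg.rieszInv_precompSym, kdual, FockAlg.rieszInv_toDual, sym_sym, kip]

theorem finite_exteriorAlgebra (V : Type*) [AddCommGroup V] [Module ℂ V] [FiniteDimensional ℂ V] :
    FiniteDimensional ℂ (ExteriorAlgebra ℂ V) :=
  Module.Finite.of_basis (Module.finBasis ℂ V).ExteriorAlgebra

theorem finite_span_ιMulti {V : Type*} [AddCommGroup V] [Module ℂ V] (D : Submodule ℂ V)
    [FiniteDimensional ℂ D] : FiniteDimensional ℂ (Submodule.span ℂ {x : ExteriorAlgebra ℂ V |
      ∃ (n : ℕ) (f : Fin n → V), (∀ i, f i ∈ D) ∧ x = ExteriorAlgebra.ιMulti ℂ n f}) := by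
  have := finite_exteriorAlgebra D
  have hle : Submodule.span ℂ {x : ExteriorAlgebra ℂ V |
      ∃ (n : ℕ) (f : Fin n → V), (∀ i, f i ∈ D) ∧ x = ExteriorAlgebra.ιMulti ℂ n f} ≤
      LinearMap.range (ExteriorAlgebra.map D.subtype).toLinearMap := by
    refine Submodule.span_le.2 ?_
    rintro _ ⟨n, f, hf, rfl⟩
    exact ⟨ExteriorAlgebra.ιMulti ℂ n fun i => (⟨f i, hf i⟩ : D),
      ExteriorAlgebra.map_apply_ιMulti _ _⟩
  exact Submodule.finiteDimensional_of_le hle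

namespace FinSub

/-- The Fock subspace `𝓕(K) ⊆ 𝓕(L)` of a finite-dimensional subspace `K ⊆ L`: the span of
the generating states with all arguments in `K` (for `n = 0` this includes the vacuum `1`). -/
def fock (K : FinSub L) : Submodule ℂ (FockAlg L) :=
  Submodule.span ℂ {ψ | ∃ (n : ℕ) (ξ : Fin n → L), (∀ i, ξ i ∈ K.1) ∧ ψ = FockAlg.cs ξ}

instance (K : FinSub L) : FiniteDimensional ℂ K.fock := by
  have := K.2
  let D : Submodule ℂ (StrongDual ℂ L) := K.1.map (kdual L)
  have hD : FiniteDimensional ℂ D := by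
    rw [← Submodule.fg_iff_finiteDimensional]
    exact ((Submodule.fg_iff_finiteDimensional _).2 this).map (kdual L)
  have h := finite_span_ιMulti D
  refine @Submodule.finiteDimensional_of_le _ _ _ _ _ _ _ h (Submodule.span_mono ?_)
  rintro _ ⟨n, ξ, hξ, rfl⟩
  exact ⟨n, _, fun i => Submodule.mem_map_of_mem (hξ i), rfl⟩

/-- The image of `𝓕(K)` in the completed Fock space. -/
def fockImage (K : FinSub L) : Submodule ℂ (FockSpace L) :=
  K.fock.map (UniformSpace.Completion.toComplₗᵢ : FockAlg L →ₗᵢ[ℂ] FockSpace L).toLinearMap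

instance (K : FinSub L) : FiniteDimensional ℂ K.fockImage := by
  unfold fockImage; infer_instance

/-- The orthogonal projector of the Fock space `𝓕(L)` onto the Fock subspace `𝓕(K)`. As `𝓕(K)`
consists of finite linear combinations of generating states, it takes values in `FockAlg L`. -/
def proj (K : FinSub L) : FockSpace L →ₗ[ℂ] FockAlg L :=
  K.fock.subtype ∘ₗ (Submodule.equivMapOfInjective
    (UniformSpace.Completion.toComplₗᵢ : FockAlg L →ₗᵢ[ℂ] FockSpace L).toLinearMap
    (UniformSpace.Completion.toComplₗᵢ : FockAlg L →ₗᵢ[ℂ] FockSpace L).injective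
    K.fock).symm.toLinearMap ∘ₗ (K.fockImage.orthogonalProjectionOnto).toLinearMap

theorem coe_proj (K : FinSub L) (x : FockSpace L) :
    (K.proj x : FockSpace L) = K.fockImage.starProjection x := by
  let e := Submodule.equivMapOfInjective
    (UniformSpace.Completion.toComplₗᵢ : FockAlg L →ₗᵢ[ℂ] FockSpace L).toLinearMap
    (UniformSpace.Completion.toComplₗᵢ : FockAlg L →ₗᵢ[ℂ] FockSpace L).injective K.fock
  exact congrArg (Subtype.val : K.fockImage → FockSpace L)
    (e.apply_symm_apply (K.fockImage.orthogonalProjectionOnto x))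

end FinSub

end

/-! The product entering the amplitude map -/

/-- The index `j` among the first half of `0, …, m - 1`. -/
def lowIndex {m : ℕ} (j : Fin (m / 2)) : Fin m := Fin.castLE (Nat.div_le_self m 2) j

section
variable {W : Type*} [AddCommGroup W] [Module ℂ W] (B : W →ₗ[ℂ] W →ₗ[ℂ] ℂ)

theorem exists_lowIndex {m : ℕ} (hm : Even m) (i : Fin m) :
    ∃ j : Fin (m / 2), i = lowIndex j ∨ i = (lowIndex j).rev := by
  obtain ⟨k, rfl⟩ := hm
  by_cases h : (i : ℕ) < k
  · exact ⟨⟨i, by omega⟩, Or.inl (by ext; simp [lowIndex])⟩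
  · exact ⟨⟨k + k - 1 - i, by omega⟩, Or.inr (by ext; simp [lowIndex]; omega)⟩

theorem lowIndex_ne_rev {m : ℕ} (j j' : Fin (m / 2)) : lowIndex j ≠ (lowIndex j').rev := by
  intro h
  have := congrArg Fin.val h
  simp [lowIndex, Fin.val_rev] at this
  omega

theorem lowIndex_inj {m : ℕ} {j j' : Fin (m / 2)} : lowIndex j = lowIndex j' ↔ j = j' :=
  (Fin.castLE_injective _).eq_iff

/-- `(f₀, …, f_{m-1}) ↦ ∏ⱼ B(fⱼ, f_{m-1-j})`, with `j` running over `0, …, m/2 - 1`. -/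
def pairProd {m : ℕ} (hm : Even m) : MultilinearMap ℂ (fun _ : Fin m => W) ℂ where
  toFun f := ∏ j : Fin (m / 2), B (f (lowIndex j)) (f (lowIndex j).rev)
  map_update_add' := by
    intro _ f i x y
    obtain ⟨j, hj⟩ := exists_lowIndex hm i
    have h (z : W) : ∏ k ∈ Finset.univ.erase j, B (Function.update f i z (lowIndex k))
        (Function.update f i z (lowIndex k).rev) =
        ∏ k ∈ Finset.univ.erase j, B (f (lowIndex k)) (f (lowIndex k).rev) := by
      refine Finset.prod_congr rfl fun k hk => ?_
      have hk := Finset.ne_of_mem_erase hk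
      rcases hj with rfl | rfl
      · rw [Function.update_of_ne (lowIndex_inj.not.2 hk),
          Function.update_of_ne (lowIndex_ne_rev _ _).symm]
      · rw [Function.update_of_ne (lowIndex_ne_rev _ _),
          Function.update_of_ne (Fin.rev_inj.not.2 (lowIndex_inj.not.2 hk))]
    simp only [← Finset.mul_prod_erase Finset.univ _ (Finset.mem_univ j), h]
    rcases hj with rfl | rfl
    · simp [(lowIndex_ne_rev _ _).symm, add_mul]
    · simp [lowIndex_ne_rev, add_mul]
  map_update_smul' := by
    intro _ f i c x
    obtain ⟨j, hj⟩ := exists_lowIndex hm i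
    have h (z : W) : ∏ k ∈ Finset.univ.erase j, B (Function.update f i z (lowIndex k))
        (Function.update f i z (lowIndex k).rev) =
        ∏ k ∈ Finset.univ.erase j, B (f (lowIndex k)) (f (lowIndex k).rev) := by
      refine Finset.prod_congr rfl fun k hk => ?_
      have hk := Finset.ne_of_mem_erase hk
      rcases hj with rfl | rfl
      · rw [Function.update_of_ne (lowIndex_inj.not.2 hk),
          Function.update_of_ne (lowIndex_ne_rev _ _).symm]
      · rw [Function.update_of_ne (lowIndex_ne_rev _ _),
          Function.update_of_ne (Fin.rev_inj.not.2 (lowIndex_inj.not.2 hk))]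
    simp only [← Finset.mul_prod_erase Finset.univ _ (Finset.mem_univ j), h]
    rcases hj with rfl | rfl
    · simp [(lowIndex_ne_rev _ _).symm, mul_assoc]
    · simp [lowIndex_ne_rev, mul_assoc]
end

/-! Spacetime systems and classical data -/

/-- A spacetime system. Regions and hypersurfaces enter the axioms of the classical and of the
quantum theory only through the operations collected here; the oriented manifolds themselves are
not recorded, so every spacetime system of oriented manifolds is an instance. Since `Decomposition`,
`Union` and `Gluing` are types, different ways of decomposing or gluing are kept apart. A copy of a
hypersurface is the same hypersurface. -/
structure SpacetimeSystem where
  /-- (admissible) hypersurfaces -/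
  Hyp : Type u
  /-- orientation reversal -/
  rev : Hyp → Hyp
  rev_rev : ∀ S, rev (rev S) = S
  /-- `Decomposition s S`: the ways in which `S` is the disjoint union of `s 0, …, s (n - 1)` -/
  Decomposition : ∀ {n : ℕ}, (Fin n → Hyp) → Hyp → Type v
  /-- (admissible) regions: regular regions and slice regions -/
  Region : Type u
  /-- the oriented boundary -/
  bd : Region → Hyp
  /-- the slice region of a hypersurface -/
  slice : Hyp → Region
  sliceBd : ∀ S, Decomposition ![S, rev S] (bd (slice S))
  slice_rev : ∀ S, slice (rev S) = slice S
  /-- `Union M₁ M₂ M`: the ways in which `M` is the disjoint union of `M₁` and `M₂` -/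
  Union : Region → Region → Region → Type v
  unionBd : ∀ {M₁ M₂ M}, Union M₁ M₂ M → Decomposition ![bd M₁, bd M₂] (bd M)
  /-- `Gluing M M₁ S`: the ways in which `M₁` is obtained from `M` by gluing `M` to itself along
  two boundary components `S` and `rev S'`, with `S'` a copy of `S` -/
  Gluing : Region → Region → Hyp → Type v
  gluingBd : ∀ {M M₁ S}, Gluing M M₁ S → Decomposition ![bd M₁, S, rev S] (bd M)

/-- A linear fermionic classical field theory on a spacetime system: the fermionic version of the axioms
of the classical theory. -/
structure ClassicalTheory (X : SpacetimeSystem.{u, v}) where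
  /-- a complex separable Krein space for each hypersurface -/
  L : X.Hyp → Type w
  [normed : ∀ S, NormedAddCommGroup (L S)]
  [innerProd : ∀ S, InnerProductSpace ℂ (L S)]
  [complete : ∀ S, CompleteSpace (L S)]
  [separable : ∀ S, TopologicalSpace.SeparableSpace (L S)]
  [krein : ∀ S, KreinSpace (L S)]
  /-- the conjugate linear involution for orientation reversal -/
  bar : ∀ S, L S ≃L⋆[ℂ] L (X.rev S)
  bar_bar : ∀ S (x : L S), HEq (bar (X.rev S) (bar S x)) x
  kip_bar : ∀ S (x y : L S), kip (bar S x) (bar S y) = -conj (kip x y)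
  /-- the isometric isomorphism for a decomposition -/
  iso : ∀ {n : ℕ} {s : Fin n → X.Hyp} {S : X.Hyp}, X.Decomposition s S →
    ((∀ i, L (s i)) ≃L[ℂ] L S)
  kip_iso : ∀ {n : ℕ} {s : Fin n → X.Hyp} {S : X.Hyp} (δ : X.Decomposition s S)
    (x y : ∀ i, L (s i)), kip (iso δ x) (iso δ y) = ∑ i, kip (x i) (y i)
  /-- a real vector space for each region -/
  LReg : X.Region → Type w
  [lregGroup : ∀ M, AddCommGroup (LReg M)]
  [lregModule : ∀ M, Module ℝ (LReg M)]
  /-- the restriction of solutions to the boundary -/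
  r : ∀ M, LReg M →ₗ[ℝ] L (X.bd M)
  neutral : ∀ M, IsRealHypermaximalNeutral (LinearMap.range (r M))
  compatible : ∀ M, IsCompatible (LinearMap.range (r M))
  /-- disjoint unions of regions -/
  unionEquiv : ∀ {M₁ M₂ M : X.Region}, X.Union M₁ M₂ M → (LReg M₁ × LReg M₂) ≃ₗ[ℝ] LReg M
  r_union : ∀ {M₁ M₂ M : X.Region} (d : X.Union M₁ M₂ M) (x : LReg M₁) (y : LReg M₂),
    r M (unionEquiv d (x, y)) = iso (X.unionBd d) (Fin.cons (r M₁ x) (Fin.cons (r M₂ y) finZeroElim))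
  /-- gluing: `glue` is injective, its image is the equalizer of the two maps
  `LReg M ⇉ L S`, and it is compatible with restriction to the boundary -/
  glue : ∀ {M M₁ : X.Region} {S : X.Hyp}, X.Gluing M M₁ S → (LReg M₁ →ₗ[ℝ] LReg M)
  glue_injective : ∀ {M M₁ : X.Region} {S : X.Hyp} (g : X.Gluing M M₁ S),
    Function.Injective (glue g)
  glue_exact : ∀ {M M₁ : X.Region} {S : X.Hyp} (g : X.Gluing M M₁ S) (x : LReg M),
    x ∈ LinearMap.range (glue g) ↔
      bar S ((iso (X.gluingBd g)).symm (r M x) 1) = (iso (X.gluingBd g)).symm (r M x) 2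
  r_glue : ∀ {M M₁ : X.Region} {S : X.Hyp} (g : X.Gluing M M₁ S) (x : LReg M₁),
    (iso (X.gluingBd g)).symm (r M (glue g x)) 0 = r M₁ x

attribute [instance] ClassicalTheory.normed ClassicalTheory.innerProd ClassicalTheory.complete
  ClassicalTheory.separable ClassicalTheory.krein ClassicalTheory.lregGroup
  ClassicalTheory.lregModule

namespace ClassicalTheory

variable {X : SpacetimeSystem.{u, v}} (T : ClassicalTheory.{u, v, w} X)

/-- The subspace of boundary data of solutions. -/
def bdSol (M : X.Region) : Submodule ℝ (T.L (X.bd M)) := LinearMap.range (T.r M)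

/-- The complex conjugation of `L (∂M)` with fixed point set `bdSol M`. -/
def conjugation (M : X.Region) : T.L (X.bd M) →ₛₗ[starRingEnd ℂ] T.L (X.bd M) := (T.compatible M).choose

theorem conjugation_spec (M : X.Region) : IsConjugation (T.bdSol M) (T.conjugation M) := (T.compatible M).choose_spec

/-! The amplitude -/

/-- The bilinear form `({ξ, ·}, {η, ·}) ↦ {ξ, u η}`. -/
def ampBil (M : X.Region) :
    StrongDual ℂ (T.L (X.bd M)) →ₗ[ℂ] StrongDual ℂ (T.L (X.bd M)) →ₗ[ℂ] ℂ :=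
  LinearMap.mk₂ ℂ (fun f g => f (T.conjugation M (kdualInv _ g)))
    (fun _ _ _ => rfl) (fun _ _ _ => rfl) (fun _ _ _ => by simp) (fun _ _ _ => by simp)

/-- `ampBil` is `{ξ̂, η̂}` for `ξ̂ = ξᴿ - i ξᴵ`, where `ξ = ξᴿ + J ξᴵ` with `ξᴿ`, `ξᴵ` boundary data
of solutions and `{·, ·}` is extended complex bilinearly to the complexification of the real
space of boundary data of solutions. -/
theorem ampBil_kdual (M : X.Region) {a b c d : T.L (X.bd M)} (_ha : a ∈ T.bdSol M)
    (_hb : b ∈ T.bdSol M) (hc : c ∈ T.bdSol M) (hd : d ∈ T.bdSol M) :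
    T.ampBil M (kdual _ (a + Complex.I • b)) (kdual _ (c + Complex.I • d)) =
      kip a c - Complex.I * kip a d - Complex.I * kip b c + Complex.I ^ 2 * kip b d := by
  have h := T.conjugation_spec M
  have hc' : T.conjugation M c = c := (h.mem_iff c).1 hc
  have hd' : T.conjugation M d = d := (h.mem_iff d).1 hd
  rw [ampBil, LinearMap.mk₂_apply, kdualInv_kdual, kdual_apply, map_add, map_smulₛₗ, hc', hd']
  simp only [kip, map_add, map_smul, inner_add_left, inner_add_right, inner_smul_left,
    inner_smul_right, Complex.conj_I]
  ring_nf

/-- The decomposition `ξ = ξᴿ + J ξᴵ` always exists. -/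
theorem exists_decomp (M : X.Region) (x : T.L (X.bd M)) :
    ∃ a ∈ T.bdSol M, ∃ b ∈ T.bdSol M, x = a + Complex.I • b := by
  have h := T.conjugation_spec M
  refine ⟨(2⁻¹ : ℂ) • (x + T.conjugation M x), (h.mem_iff _).2 ?_,
    (-Complex.I * 2⁻¹) • (x - T.conjugation M x), (h.mem_iff _).2 ?_, ?_⟩
  · rw [map_smulₛₗ, map_add, h.involutive, add_comm, map_inv₀, Complex.conj_ofNat]
  · rw [map_smulₛₗ, map_sub, h.involutive, ← neg_sub, smul_neg, ← neg_smul, map_mul, map_neg,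
      map_inv₀, Complex.conj_I, Complex.conj_ofNat, neg_neg, ← neg_mul]
  · rw [smul_smul, ← mul_assoc, mul_neg, Complex.I_mul_I, neg_neg, one_mul, smul_add, smul_sub]
    module

/-- The alternating form `1/n! ∑_σ sgn σ ∏ⱼ ampBil (f_σ(j), f_σ(2n+1-j))` in degree `2n`, and zero
in odd degree. -/
def ampAlternating (M : X.Region) (m : ℕ) : StrongDual ℂ (T.L (X.bd M)) [⋀^Fin m]→ₗ[ℂ] ℂ :=
  if hm : Even m then ((m / 2)! : ℂ)⁻¹ • (pairProd (T.ampBil M) hm).alternatization else 0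

/-- The amplitude map. -/
def amp (M : X.Region) : FockAlg (T.L (X.bd M)) →ₗ[ℂ] ℂ :=
  ExteriorAlgebra.liftAlternating (T.ampAlternating M)

theorem amp_cs_odd (M : X.Region) {m : ℕ} (hm : ¬ Even m) (ξ : Fin m → T.L (X.bd M)) :
    T.amp M (FockAlg.cs ξ) = 0 := by
  refine (ExteriorAlgebra.liftAlternating_apply_ιMulti _ _).trans ?_
  simp [ampAlternating, hm]

theorem amp_cs_even (M : X.Region) {m : ℕ} (hm : Even m) (ξ : Fin m → T.L (X.bd M)) :
    T.amp M (FockAlg.cs ξ) = ((m / 2)! : ℂ)⁻¹ * ∑ σ : Equiv.Perm (Fin m),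
      ((Equiv.Perm.sign σ : ℤ) : ℂ) * ∏ j : Fin (m / 2),
        T.ampBil M (kdual _ (ξ (σ (lowIndex j)))) (kdual _ (ξ (σ (lowIndex j).rev))) := by
  refine (ExteriorAlgebra.liftAlternating_apply_ιMulti _ _).trans ?_
  simp only [ampAlternating, hm, dif_pos, AlternatingMap.smul_apply,
    MultilinearMap.alternatization_apply, smul_eq_mul, MultilinearMap.domDomCongr_apply]
  congr 1
  refine Finset.sum_congr rfl fun σ _ => ?_
  rw [Units.smul_def, zsmul_eq_mul]
  rfl

theorem amp_one (M : X.Region) : T.amp M 1 = 1 := by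
  have h : (1 : FockAlg (T.L (X.bd M))) = FockAlg.cs (Fin.elim0 : Fin 0 → T.L (X.bd M)) :=
    (ExteriorAlgebra.ιMulti_zero_apply _).symm
  rw [h, amp_cs_even _ _ (by simp)]
  simp

/-! The maps `ι` and `τ` -/

/-- `f ↦ conj ∘ f`, the arguments being transported along `bar`. -/
def barDual (S : X.Hyp) :
    StrongDual ℂ (T.L S) →ₛₗ[starRingEnd ℂ] StrongDual ℂ (T.L (X.rev S)) where
  toFun f :=
    { toFun := fun x => conj (f ((T.bar S).symm x))
      map_add' := fun x y => by simp
      map_smul' := fun c x => by simp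
      cont := by fun_prop }
  map_add' f g := by ext; simp
  map_smul' c f := by ext; simp

/-- `ι_S`, given by `(ι ψ)(ξ₁, …, ξₙ) = conj (ψ(ξₙ, …, ξ₁))`. -/
def iota (S : X.Hyp) : FockAlg (T.L S) →ₛₗ[starRingEnd ℂ] FockAlg (T.L (X.rev S)) :=
  (CliffordAlgebra.reverse : ExteriorAlgebra ℂ (StrongDual ℂ (T.L (X.rev S))) →ₗ[ℂ]
    ExteriorAlgebra ℂ (StrongDual ℂ (T.L (X.rev S)))).comp (extConj (T.barDual S))

/-- The pullback of linear forms along the projection `L S → L (s i)` of a decomposition. -/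
def pullDual {n : ℕ} {s : Fin n → X.Hyp} {S : X.Hyp} (δ : X.Decomposition s S) (i : Fin n) :
    StrongDual ℂ (T.L (s i)) →ₗ[ℂ] StrongDual ℂ (T.L S) where
  toFun f := f.comp ((ContinuousLinearMap.proj i).comp (T.iso δ).symm.toContinuousLinearMap)
  map_add' _ _ := rfl
  map_smul' _ _ := rfl

/-- The pullback of forms along the projection `L S → L (s i)` of a decomposition. -/
def pull {n : ℕ} {s : Fin n → X.Hyp} {S : X.Hyp} (δ : X.Decomposition s S) (i : Fin n) :
    FockAlg (T.L (s i)) →ₐ[ℂ] FockAlg (T.L S) :=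
  ExteriorAlgebra.map (T.pullDual δ i)

/-- `τ(ψ ⊗ x ⊗ y)` for a decomposition into three hypersurfaces: the antisymmetrized product of
the pullbacks. -/
def tau {S₁ S₂ S₃ S : X.Hyp} (δ : X.Decomposition ![S₁, S₂, S₃] S) (ψ : FockAlg (T.L S₁))
    (x : FockAlg (T.L S₂)) (y : FockAlg (T.L S₃)) : FockAlg (T.L S) :=
  T.pull δ 0 ψ * T.pull δ 1 x * T.pull δ 2 y

/-- The summand
`(-1)^[ζ] ρ_M (τ(ψ ⊗ P_K ζ ⊗ ι (P_K ζ)))` of the regularized right hand side of the gluing axiom. -/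
def glueTerm {M M₁ : X.Region} {S : X.Hyp} (g : X.Gluing M M₁ S) (K : FinSub (T.L S))
    (ψ : FockAlg (T.L (X.bd M₁))) (ζ : FockSpace (T.L S)) : ℂ :=
  (-1) ^ sig ζ * T.amp M (T.tau (X.gluingBd g) ψ (K.proj ζ) (T.iota S (K.proj ζ)))

end ClassicalTheory

end

/-! The amplitude is a Gaussian functional, and such a functional is pinned down by linear
identities that survive gluing. With `B` the alternating form `{ξ, u η}` on one-forms, the
permutation sum defining `ρ_M` solves the Wick recursion `ρ(1) = 1`, `ρ(f ∧ x) = 2 ρ(B f ⌟ x)`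
(`amp_eq_wick`). For boundary data `ξ` of a solution, `B {ξ, ·}` is minus evaluation at `ξ`. Writing
`a†_ξ` for multiplication by `{ξ, ·}` and `a_ξ` for twice the contraction with `ξ`, this gives `ρ_M
∘ a†_ξ = -ρ_M ∘ a_ξ` (`amp_wedge_kdual`). Conversely, the Wick rule for `f₁, …, fₙ` fixes a
functional on `f₁ ∧ ⋯ ∧ fₙ` up to its value on the vacuum (`SatisfiesWick.apply_ιMulti`), and every
one-form is a complex combination of two coming from solutions.

The regularized sum over any ON-basis equals `ρ_M(ψ ∧ Θ_K)`, where `Θ_K` is the finite sum of `P_K Γ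
e ⊗ ι e` over an orthonormal basis of `𝓕(K)` (`hasSum_glueTerm`). Hence the sums converge, do not
depend on the basis, and `c_K = ρ_M(Θ_K)`.

A solution on `M₁` extends to a solution on `M` with boundary data `ξ = (r x, χ, bar χ)`. Because
the last two components match, the one-form of `(χ, bar χ)` acts on `Θ_K` as `-a_ξ`, provided `χ`
and `sym χ` lie in `K` (`wedge_sewPair`). In the identity of `ρ_M` for `ξ` the contributions of the
glued legs then cancel, and `ψ ↦ ρ_M(ψ ∧ Θ_K)` obeys the Wick rule of `M₁` for `{r x, ·}`. A given
`ψ` involves finitely many one-forms, so for all large `K` the equality `ρ_M(ψ ∧ Θ_K) = ρ_{M₁}(ψ)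
c_K` is exact. The numbers `c_K` themselves need not converge, which is why no integrability
condition enters. -/

section Gluing

open KreinSpace

/-! Contractions of the exterior algebra -/

namespace ExteriorAlgebra

section
variable {R V W : Type*} [CommRing R] [AddCommGroup V] [Module R V] [AddCommGroup W] [Module R W]

theorem induction_ι_mul {p : ExteriorAlgebra R V → Prop} (h1 : p 1)
    (hadd : ∀ x y, p x → p y → p (x + y)) (hsmul : ∀ (c : R) x, p x → p (c • x))
    (hmul : ∀ v x, p x → p (ι R v * x)) (x : ExteriorAlgebra R V) : p x := by
  refine CliffordAlgebra.left_induction (0 : QuadraticForm R V) (P := p) (fun r => ?_) hadd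
    (fun x v hx => hmul v x hx) x
  rw [Algebra.algebraMap_eq_smul_one]
  exact hsmul r 1 h1

/-- The contraction (left antiderivation) with a linear form. -/
abbrev contract (d : Module.Dual R V) : ExteriorAlgebra R V →ₗ[R] ExteriorAlgebra R V :=
  CliffordAlgebra.contractLeft (Q := 0) d

/-- The parity automorphism. -/
abbrev parity : ExteriorAlgebra R V →ₐ[R] ExteriorAlgebra R V :=
  CliffordAlgebra.involute (Q := 0)

theorem contract_one (d : Module.Dual R V) : contract d (1 : ExteriorAlgebra R V) = 0 :=
  CliffordAlgebra.contractLeft_one _ _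

theorem contract_ι_mul (d : Module.Dual R V) (v : V) (x : ExteriorAlgebra R V) :
    contract d (ι R v * x) = d v • x - ι R v * contract d x :=
  CliffordAlgebra.contractLeft_ι_mul _ _ _

theorem parity_ι (v : V) : parity (ι R v) = -ι R v :=
  CliffordAlgebra.involute_ι v

theorem parity_parity (x : ExteriorAlgebra R V) : parity (parity x) = x :=
  CliffordAlgebra.involute_involute x

theorem contract_mul (d : Module.Dual R V) (x y : ExteriorAlgebra R V) :
    contract d (x * y) = contract d x * y + parity x * contract d y := by
  induction x using induction_ι_mul with
  | h1 => simp
  | hadd a b ha hb => simp only [add_mul, map_add, ha, hb]; abel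
  | hsmul c a ha => simp only [smul_mul_assoc, map_smul, ha, smul_add]
  | hmul v a ha =>
    rw [mul_assoc, contract_ι_mul, ha, contract_ι_mul, map_mul, parity_ι]
    simp only [mul_add, sub_mul, smul_mul_assoc, neg_mul, mul_assoc]
    abel

theorem contract_mul_ι (d : Module.Dual R V) (x : ExteriorAlgebra R V) (v : V) :
    contract d (x * ι R v) = contract d x * ι R v + d v • parity x := by
  rw [contract_mul]
  congr 1
  have h : contract d (ι R v) = algebraMap R _ (d v) := CliffordAlgebra.contractLeft_ι _ _ _
  rw [h, ← Algebra.commutes, Algebra.smul_def]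

theorem ι_mul_eq_parity_mul (v : V) (x : ExteriorAlgebra R V) :
    ι R v * x = parity x * ι R v := by
  induction x using induction_ι_mul with
  | h1 => simp
  | hadd a b ha hb => simp only [add_mul, mul_add, map_add, ha, hb]
  | hsmul c a ha => simp only [smul_mul_assoc, map_smul, mul_smul_comm, ha]
  | hmul w a ha =>
    rw [map_mul, parity_ι, mul_assoc, ← ha, ← mul_assoc, ← mul_assoc]
    congr 1
    rw [neg_mul, eq_neg_iff_add_eq_zero]
    exact ι_add_mul_swap v w

theorem contract_map (F : V →ₗ[R] W) (d : Module.Dual R W) (x : ExteriorAlgebra R V) :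
    contract d (map F x) = map F (contract (d ∘ₗ F) x) := by
  induction x using induction_ι_mul with
  | h1 => simp
  | hadd a b ha hb => simp only [map_add, ha, hb]
  | hsmul c a ha => simp only [map_smul, ha]
  | hmul w a ha =>
    rw [map_mul, map_apply_ι, contract_ι_mul, contract_ι_mul, ha, map_sub, map_smul, map_mul,
      map_apply_ι]
    rfl

theorem parity_map (F : V →ₗ[R] W) (x : ExteriorAlgebra R V) :
    parity (map F x) = map F (parity x) := by
  induction x using induction_ι_mul with
  | h1 => simp
  | hadd a b ha hb => simp only [map_add, ha, hb]
  | hsmul c a ha => simp only [map_smul, ha]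
  | hmul w a ha => simp only [map_mul, map_apply_ι, parity_ι, ha, map_neg]

/-- Reversal turns the left antiderivation into the right one, and in degree `n` the two differ by
`(-1)^(n-1)`. Needed because `ι_S` reverses the order of the factors. -/
theorem contract_reverse (d : Module.Dual R V) (x : ExteriorAlgebra R V) :
    contract d (CliffordAlgebra.reverse x) = -CliffordAlgebra.reverse (contract d (parity x)) := by
  induction x using induction_ι_mul with
  | h1 => simp
  | hadd a b ha hb => simp only [map_add, ha, hb, neg_add]
  | hsmul c a ha => simp only [map_smul, ha, smul_neg]
  | hmul w a ha =>
    have hr (y : ExteriorAlgebra R V) : CliffordAlgebra.reverse (ι R w * y) =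
        CliffordAlgebra.reverse y * ι R w := by
      rw [CliffordAlgebra.reverse.map_mul]; congr 1; exact CliffordAlgebra.reverse_ι w
    have hc : parity (CliffordAlgebra.reverse a) = CliffordAlgebra.reverse (parity a) :=
      (CliffordAlgebra.reverse_involute_commute (Q := (0 : QuadraticForm R V))).symm.eq a
    rw [hr, contract_mul_ι, ha, map_mul, parity_ι, neg_mul, neg_mul, map_neg (contract d),
      contract_ι_mul, map_neg, map_sub, hr, map_smul, hc]
    abel

theorem contract_ιMulti_succ (d : Module.Dual R V) {n : ℕ} (f : Fin (n + 1) → V) :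
    contract d (ιMulti R (n + 1) f) =
      ∑ i : Fin (n + 1), ((-1) ^ (i : ℕ) * d (f i)) • ιMulti R n (i.removeNth f) := by
  induction n with
  | zero => simp [ιMulti_succ_apply, Algebra.algebraMap_eq_smul_one]
  | succ n ih =>
    rw [ιMulti_succ_apply, contract_ι_mul, ih, Finset.mul_sum,
      Fin.sum_univ_succ (n := n + 1), sub_eq_add_neg,
      ← Finset.sum_neg_distrib]
    congr 1
    · simp [Fin.removeNth_zero]; rfl
    · refine Finset.sum_congr rfl fun i _ => ?_
      rw [ιMulti_succ_apply (n := n), mul_smul_comm, ← neg_smul]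
      congr 1
      · simp [pow_succ, Matrix.vecTail]
      · congr 2
        ext j
        simp [Matrix.vecTail, Fin.removeNth]

theorem parity_ιMulti {n : ℕ} (f : Fin n → V) :
    parity (ιMulti R n f) = (-1 : R) ^ n • ιMulti R n f := by
  induction n with
  | zero => simp [ιMulti_zero_apply]
  | succ n ih =>
    rw [ιMulti_succ_apply, map_mul, ih, parity_ι, pow_succ]
    simp
end

section
variable {V W : Type*} [AddCommGroup V] [Module ℂ V] [AddCommGroup W] [Module ℂ W]

theorem contract_extConj (F : V →ₛₗ[starRingEnd ℂ] W) (d : Module.Dual ℂ W) (d' : Module.Dual ℂ V)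
    (hd : ∀ x, d' x = conj (d (F x))) (x : ExteriorAlgebra ℂ V) :
    contract d (extConj F x) = extConj F (contract d' x) := by
  induction x using induction_ι_mul with
  | h1 => simp [extConj_one]
  | hadd a b ha hb => simp only [map_add, ha, hb]
  | hsmul c a ha => simp only [map_smulₛₗ, ha, RingHom.id_apply]
  | hmul w a ha =>
    rw [extConj_mul, extConj_ι, contract_ι_mul, contract_ι_mul, ha, map_sub, extConj_mul,
      extConj_ι, map_smulₛₗ, hd, Complex.conj_conj]

theorem parity_extConj (F : V →ₛₗ[starRingEnd ℂ] W) (x : ExteriorAlgebra ℂ V) :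
    parity (extConj F x) = extConj F (parity x) := by
  induction x using induction_ι_mul with
  | h1 => simp [extConj_one]
  | hadd a b ha hb => simp only [map_add, ha, hb]
  | hsmul c a ha => simp only [map_smulₛₗ, ha, RingHom.id_apply]
  | hmul w a ha => simp only [extConj_mul, map_mul, extConj_ι, parity_ι, ha, map_neg, neg_mul]
end

end ExteriorAlgebra

/-! The Wick expansion of the amplitude -/

section Wick
open ExteriorAlgebra
variable {W : Type*} [AddCommGroup W] [Module ℂ W] {B : W →ₗ[ℂ] W →ₗ[ℂ] ℂ}

/-- The functional on the exterior algebra with `wick 1 = 1` and `wick (v ∧ x) = 2 wick (B v ⌟ x)`. -/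
noncomputable def wick (hB : ∀ v, B v v = 0) : ExteriorAlgebra ℂ W →ₗ[ℂ] ℂ :=
  algebraMapInv.toLinearMap ∘ₗ CliffordAlgebra.changeForm (Q := 0) (Q' := 0) (B := (-2 : ℂ) • B) (by
    -- `changeForm` requires the quadratic form of `-2B` to be the difference of two zero forms,
    -- which holds because `B` is alternating.
    ext v
    simp [hB])

theorem wick_one (hB : ∀ v, B v v = 0) : wick hB 1 = 1 := by
  simp [wick]

/-- If `x'` is the image of `x` under `changeForm`, then `v ∧ x` goes to `v ∧ x' + 2 B v ⌟ x'`. The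
scalar part kills the first summand, and `changeForm` commutes with contractions. -/
theorem wick_ι_mul (hB : ∀ v, B v v = 0) (v : W) (x : ExteriorAlgebra ℂ W) :
    wick hB (ι ℂ v * x) = 2 * wick hB (contract (B v) x) := by
  simp [wick, CliffordAlgebra.changeForm_ι_mul, CliffordAlgebra.changeForm_contractLeft,
    algebraMapInv]

theorem wick_ιMulti_add_two (hB : ∀ v, B v v = 0) {k : ℕ} (f : Fin (k + 2) → W) :
    wick hB (ιMulti ℂ (k + 2) f) = 2 * ∑ i : Fin (k + 1), (-1) ^ (i : ℕ) * B (f 0) (f i.succ) *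
      wick hB (ιMulti ℂ k fun j => f (i.succAbove j).succ) := by
  rw [ιMulti_succ_apply, wick_ι_mul, contract_ιMulti_succ, map_sum]
  simp only [map_smul, smul_eq_mul]
  rfl

theorem sum_sign_mul_comp {n : ℕ} (q : (Fin n → W) → ℂ) (f : Fin n → W) (π : Equiv.Perm (Fin n)) :
    ∑ σ : Equiv.Perm (Fin n), ((Equiv.Perm.sign σ : ℤ) : ℂ) * q (f ∘ σ ∘ π) =
      ((Equiv.Perm.sign π : ℤ) : ℂ) *
        ∑ σ : Equiv.Perm (Fin n), ((Equiv.Perm.sign σ : ℤ) : ℂ) * q (f ∘ σ) := by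
  rw [Finset.mul_sum]
  refine Fintype.sum_equiv (Equiv.mulRight π) _ _ fun σ => ?_
  have h : ((Equiv.Perm.sign π : ℤ) : ℂ) * ((Equiv.Perm.sign π : ℤ) : ℂ) = 1 := by
    rw [← Int.cast_mul, ← Units.val_mul, Int.units_mul_self]; simp
  simp only [Equiv.coe_mulRight, Equiv.Perm.sign_mul, Units.val_mul, Int.cast_mul]
  have e : f ∘ ⇑(σ * π) = f ∘ σ ∘ π := rfl
  rw [e]
  linear_combination -(((Equiv.Perm.sign σ : ℤ) : ℂ) * q (f ∘ σ ∘ π)) * h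

/-- The inclusion of the indices other than the first and the last. -/
def midEmb (k : ℕ) : Fin k ↪ Fin (k + 2) :=
  ⟨fun j => j.castSucc.succ, fun _ _ h => by simpa using h⟩

theorem midEmb_apply {k : ℕ} (j : Fin k) : midEmb k j = j.castSucc.succ := rfl

/-- Cycling one of the `k + 1` nonzero positions to the end has sign `(-1)^(k-i)`, which equals the
sign `(-1)^i` of the contraction formula precisely because `k` is even. -/
theorem exists_perm_move_last {k : ℕ} (hk : Even k) (i : Fin (k + 1)) :
    ∃ π : Equiv.Perm (Fin (k + 2)), ((Equiv.Perm.sign π : ℤ) : ℂ) = (-1) ^ (i : ℕ) ∧ π 0 = 0 ∧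
      π (Fin.last _) = i.succ ∧ ∀ j, π (midEmb k j) = (i.succAbove j).succ := by
  refine ⟨Equiv.Perm.decomposeFin.symm (0, i.cycleRange.symm * (Fin.last k).cycleRange),
    ?_, ?_, ?_, fun j => ?_⟩
  · rw [Equiv.Perm.decomposeFin.symm_sign, Equiv.Perm.sign_mul, Equiv.Perm.sign_symm,
      Fin.sign_cycleRange, Fin.sign_cycleRange]
    simp [hk.neg_one_pow]
  · simp
  · rw [← Fin.succ_last, Equiv.Perm.decomposeFin_symm_apply_succ]
    simp
  · have h : (Fin.last k).cycleRange j.castSucc = j.succ := by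
      rw [← Fin.succAbove_last, Fin.cycleRange_succAbove]
    rw [midEmb_apply, Equiv.Perm.decomposeFin_symm_apply_succ,
      Equiv.Perm.mul_apply, h, Fin.cycleRange_symm_succ]
    simp

theorem exists_perm_extend_mid {k : ℕ} (τ : Equiv.Perm (Fin k)) :
    ∃ π : Equiv.Perm (Fin (k + 2)), Equiv.Perm.sign π = Equiv.Perm.sign τ ∧ π 0 = 0 ∧
      π (Fin.last _) = Fin.last _ ∧ ∀ j, π (midEmb k j) = midEmb k (τ j) := by
  refine ⟨τ.viaFintypeEmbedding (midEmb k), Equiv.Perm.viaFintypeEmbedding_sign _ _, ?_, ?_,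
    fun j => Equiv.Perm.viaFintypeEmbedding_apply_image _ _ _⟩
  · refine Equiv.Perm.viaFintypeEmbedding_apply_notMem_range _ _ ?_
    rintro ⟨j, hj⟩
    rw [midEmb_apply] at hj
    exact Fin.succ_ne_zero _ hj
  · refine Equiv.Perm.viaFintypeEmbedding_apply_notMem_range _ _ ?_
    rintro ⟨j, hj⟩
    have := congrArg Fin.val hj
    simp [midEmb_apply] at this
    omega

/-- The pairs `(j, m-1-j)` are nested, so the outermost one can be peeled off. -/
theorem pairProd_add_two {k : ℕ} (hk : Even k) (hk' : Even (k + 2)) (f : Fin (k + 2) → W) :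
    pairProd B hk' f = B (f 0) (f (Fin.last _)) * pairProd B hk (f ∘ midEmb k) := by
  have e : k / 2 + 1 = (k + 2) / 2 := by omega
  change ∏ j : Fin ((k + 2) / 2), B (f (lowIndex j)) (f (lowIndex j).rev) =
    B (f 0) (f (Fin.last _)) * ∏ j : Fin (k / 2), B (f (midEmb k (lowIndex j)))
      (f (midEmb k (lowIndex j).rev))
  rw [← Fin.prod_congr' _ e, Fin.prod_univ_succ]
  have h0 : lowIndex (Fin.cast e 0) = (0 : Fin (k + 2)) := rfl
  rw [h0, Fin.rev_zero]
  congr 1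
  · refine Finset.prod_congr rfl fun j _ => ?_
    have h1 : lowIndex (Fin.cast e j.succ) = midEmb k (lowIndex j) := by
      ext; simp [lowIndex, midEmb_apply]
    have h2 : (midEmb k (lowIndex j)).rev = midEmb k (lowIndex j).rev := by
      ext
      simp [lowIndex, midEmb_apply, Fin.val_rev]
      omega
    rw [h1, h2]

theorem wick_ιMulti_odd (hB : ∀ v, B v v = 0) {m : ℕ} (hm : ¬ Even m) (f : Fin m → W) :
    wick hB (ιMulti ℂ m f) = 0 := by
  induction m using Nat.twoStepInduction with
  | zero => simp at hm
  | one =>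
    rw [ιMulti_succ_apply, wick_ι_mul, ιMulti_zero_apply, contract_one, map_zero, mul_zero]
  | more k ih _ =>
    rw [wick_ιMulti_add_two]
    have hk : ¬ Even k := fun h => hm (h.add even_two)
    simp [ih hk]

/-- Antisymmetrize the recursion over all permutations. Each choice of the partner of the first
factor contributes the same amount, since that partner can be moved to the last place. In the
remaining middle block, each permutation supplied by the induction hypothesis can be absorbed into
the outer sum. -/
theorem wick_ιMulti_even (hB : ∀ v, B v v = 0) {m : ℕ} (hm : Even m) (f : Fin m → W) :
    wick hB (ιMulti ℂ m f) = ((m / 2)! : ℂ)⁻¹ * ∑ σ : Equiv.Perm (Fin m),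
      ((Equiv.Perm.sign σ : ℤ) : ℂ) * pairProd B hm (f ∘ σ) := by
  induction m using Nat.twoStepInduction with
  | zero =>
    rw [ιMulti_zero_apply, wick_one]
    simp [pairProd]
  | one => simp at hm
  | more k ih _ =>
    have hk : Even k := by simpa [parity_simps] using hm
    have h1 : ((k + 2)! : ℂ) * wick hB (ιMulti ℂ (k + 2) f) =
        ∑ σ : Equiv.Perm (Fin (k + 2)), ((Equiv.Perm.sign σ : ℤ) : ℂ) *
          wick hB (ιMulti ℂ (k + 2) (f ∘ σ)) := by
      have (σ : Equiv.Perm (Fin (k + 2))) : ((Equiv.Perm.sign σ : ℤ) : ℂ) *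
          wick hB (ιMulti ℂ (k + 2) (f ∘ σ)) = wick hB (ιMulti ℂ (k + 2) f) := by
        rw [AlternatingMap.map_perm, Units.smul_def, ← Int.cast_smul_eq_zsmul ℂ, map_smul,
          smul_eq_mul, ← mul_assoc, ← Int.cast_mul, ← Units.val_mul, Int.units_mul_self]
        simp
      rw [Finset.sum_congr rfl fun σ _ => this σ]
      simp [Fintype.card_perm, -ιMulti_succ_apply]
    have h2 (i : Fin (k + 1)) : ∑ σ : Equiv.Perm (Fin (k + 2)), ((Equiv.Perm.sign σ : ℤ) : ℂ) *
        ((-1) ^ (i : ℕ) * B (f (σ 0)) (f (σ i.succ)) *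
          wick hB (ιMulti ℂ k fun j => f (σ (i.succAbove j).succ))) =
        ∑ σ : Equiv.Perm (Fin (k + 2)), ((Equiv.Perm.sign σ : ℤ) : ℂ) *
        (B (f (σ 0)) (f (σ (Fin.last _))) *
          wick hB (ιMulti ℂ k fun j => f (σ (midEmb k j)))) := by
      obtain ⟨π, hs, h0, hl, hmid⟩ := exists_perm_move_last hk i
      have := sum_sign_mul_comp (fun f' : Fin (k + 2) → W => B (f' 0) (f' (Fin.last _)) *
          wick hB (ιMulti ℂ k fun j => f' (midEmb k j))) f π
      simp only [Function.comp_apply, h0, hl, hmid, hs] at this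
      have hsq : ((-1 : ℂ) ^ (i : ℕ)) * (-1) ^ (i : ℕ) = 1 := by
        rw [← mul_pow]; simp
      have h3 := congrArg (fun z => (-1 : ℂ) ^ (i : ℕ) * z) this
      simp only [← mul_assoc, hsq, one_mul] at h3
      rw [Finset.mul_sum] at h3
      simp only [← mul_assoc]
      rw [← h3]
      exact Finset.sum_congr rfl fun σ _ => by ring
    have h4 : ∑ σ : Equiv.Perm (Fin (k + 2)), ((Equiv.Perm.sign σ : ℤ) : ℂ) *
        (B (f (σ 0)) (f (σ (Fin.last _))) *
          wick hB (ιMulti ℂ k fun j => f (σ (midEmb k j)))) =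
        ((k / 2)! : ℂ)⁻¹ * (k ! * ∑ σ : Equiv.Perm (Fin (k + 2)),
          ((Equiv.Perm.sign σ : ℤ) : ℂ) * pairProd B hm (f ∘ σ)) := by
      have h5 (τ : Equiv.Perm (Fin k)) : ∑ σ : Equiv.Perm (Fin (k + 2)),
          ((Equiv.Perm.sign σ : ℤ) : ℂ) * (B (f (σ 0)) (f (σ (Fin.last _))) *
            (((Equiv.Perm.sign τ : ℤ) : ℂ) * pairProd B hk fun j => f (σ (midEmb k (τ j))))) =
          ∑ σ : Equiv.Perm (Fin (k + 2)),
          ((Equiv.Perm.sign σ : ℤ) : ℂ) * pairProd B hm (f ∘ σ) := by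
        obtain ⟨π, hs, h0, hl, hmid⟩ := exists_perm_extend_mid τ
        have := sum_sign_mul_comp (fun f' : Fin (k + 2) → W => pairProd B hm f') f π
        have hsq : ((Equiv.Perm.sign τ : ℤ) : ℂ) * ((Equiv.Perm.sign τ : ℤ) : ℂ) = 1 := by
          rw [← Int.cast_mul, ← Units.val_mul, Int.units_mul_self]; simp
        rw [hs] at this
        have h3 := congrArg (fun z => ((Equiv.Perm.sign τ : ℤ) : ℂ) * z) this
        simp only [← mul_assoc, hsq, one_mul] at h3
        rw [← h3, Finset.mul_sum]
        refine Finset.sum_congr rfl fun σ _ => ?_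
        rw [pairProd_add_two hk hm]
        have h6 : (f ∘ ⇑σ ∘ ⇑π) ∘ ⇑(midEmb k) = fun j => f (σ (midEmb k (τ j))) := by
          ext j; simp [hmid]
        rw [h6]
        simp only [Function.comp_apply, h0, hl]
        ring
      have h7 (σ : Equiv.Perm (Fin (k + 2))) : wick hB (ιMulti ℂ k fun j => f (σ (midEmb k j))) =
          ((k / 2)! : ℂ)⁻¹ * ∑ τ : Equiv.Perm (Fin k), ((Equiv.Perm.sign τ : ℤ) : ℂ) *
            pairProd B hk fun j => f (σ (midEmb k (τ j))) := ih hk _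
      simp only [h7]
      have h8 : ∑ σ : Equiv.Perm (Fin (k + 2)), ((Equiv.Perm.sign σ : ℤ) : ℂ) *
          (B (f (σ 0)) (f (σ (Fin.last _))) * (((k / 2)! : ℂ)⁻¹ *
            ∑ τ : Equiv.Perm (Fin k), ((Equiv.Perm.sign τ : ℤ) : ℂ) *
            pairProd B hk fun j => f (σ (midEmb k (τ j))))) =
          ((k / 2)! : ℂ)⁻¹ * ∑ τ : Equiv.Perm (Fin k), ∑ σ : Equiv.Perm (Fin (k + 2)),
          ((Equiv.Perm.sign σ : ℤ) : ℂ) * (B (f (σ 0)) (f (σ (Fin.last _))) *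
            (((Equiv.Perm.sign τ : ℤ) : ℂ) * pairProd B hk fun j => f (σ (midEmb k (τ j))))) := by
        rw [Finset.sum_comm, Finset.mul_sum]
        refine Finset.sum_congr rfl fun σ _ => ?_
        simp only [Finset.mul_sum]
        exact Finset.sum_congr rfl fun τ _ => by ring
      rw [h8]
      simp [h5, Fintype.card_perm]
    -- The factor `k + 1` counts the partners of the first entry and `k!` the permutations of the
    -- middle block. With `k = 2a`, dividing by `(k + 2)!` leaves `1 / (a + 1)!`.
    have h9 : ((k + 2)! : ℂ) * wick hB (ιMulti ℂ (k + 2) f) = 2 * ((k + 1) * (((k / 2)! : ℂ)⁻¹ *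
        (k ! * ∑ σ : Equiv.Perm (Fin (k + 2)),
          ((Equiv.Perm.sign σ : ℤ) : ℂ) * pairProd B hm (f ∘ σ)))) := by
      rw [h1]
      simp only [wick_ιMulti_add_two, Function.comp_apply]
      simp only [mul_left_comm _ (2 : ℂ)]
      rw [← Finset.mul_sum, Finset.sum_congr rfl fun σ _ => Finset.mul_sum _ _ _]
      rw [Finset.sum_comm]
      rw [Finset.sum_congr rfl fun i _ => h2 i, h4]
      simp
    obtain ⟨a, rfl⟩ := hk
    have e1 : (a + a) / 2 = a := by omega
    have e2 : (a + a + 2) / 2 = a + 1 := by omega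
    rw [e1] at h9
    rw [e2]
    have f1 : ((a + a)! : ℂ) ≠ 0 := by exact_mod_cast Nat.factorial_ne_zero _
    have f2 : (a ! : ℂ) ≠ 0 := by exact_mod_cast Nat.factorial_ne_zero _
    have f3 : ((a : ℂ) + 1) ≠ 0 := Nat.cast_add_one_ne_zero a
    have f4 : ((a : ℂ) + a + 1) ≠ 0 := by
      rw [← Nat.cast_add]; exact Nat.cast_add_one_ne_zero _
    rw [Nat.factorial_succ, Nat.factorial_succ (a + a)] at h9
    rw [Nat.factorial_succ]
    push_cast at h9 ⊢
    refine mul_left_cancel₀ (mul_ne_zero (mul_ne_zero (mul_ne_zero two_ne_zero f3) f4) f1) ?_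
    refine Eq.trans ?_ (h9.trans ?_)
    · ring
    · field_simp
end Wick

/-! The adjoint of exterior multiplication, and traces -/

theorem ExteriorAlgebra.induction_ιMulti {R V : Type*} [CommRing R] [AddCommGroup V] [Module R V]
    {p : ExteriorAlgebra R V → Prop}
    (h : ∀ n (f : Fin n → V), p (ιMulti R n f)) (h0 : p 0) (hadd : ∀ x y, p x → p y → p (x + y))
    (hsmul : ∀ (c : R) x, p x → p (c • x)) (x : ExteriorAlgebra R V) : p x := by
  have hx : x ∈ Submodule.span R (Set.range fun x : (Σ n, Fin n → V) => ιMulti R x.1 x.2) := by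
    rw [ιMulti_span]; trivial
  induction hx using Submodule.span_induction with
  | mem x h' => obtain ⟨⟨n, f⟩, rfl⟩ := h'; exact h n f
  | zero => exact h0
  | add x y _ _ hx hy => exact hadd x y hx hy
  | smul c x _ hx => exact hsmul c x hx

namespace FockAlg
open ExteriorAlgebra
variable {L : Type*} [NormedAddCommGroup L] [InnerProductSpace ℂ L]

/-- The evaluation of linear forms at a vector. -/
noncomputable def evalAt (v : L) : Module.Dual ℂ (StrongDual ℂ L) where
  toFun f := f v
  map_add' _ _ := rfl
  map_smul' _ _ := rfl

theorem evalAt_apply (v : L) (f : StrongDual ℂ L) : evalAt v f = f v := rfl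

/-- Laplace expansion of the determinant along the row of `v`. The factor `2` is the quotient of the
normalizations `2^(n+1)` and `2^n`, and is the reason for the `2` in `annih`. -/
theorem pairing_ι_mul (y : ExteriorAlgebra ℂ (StrongDual ℂ L)) (v : L) (X : ExteriorAlgebra ℂ L) :
    pairing y (ι ℂ v * X) = 2 * pairing (contract (evalAt v) y) X := by
  induction X using induction_ιMulti with
  | h m ξ =>
    induction y using span_induction with
    | h n f =>
      have hv : ι ℂ v * ιMulti ℂ m ξ = ιMulti ℂ (m + 1) (Matrix.vecCons v ξ) := by
        rw [ιMulti_succ_apply]; simp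
      rw [hv]
      rcases n with _ | n
      · rw [pairing_ιMulti_ne m.succ_ne_zero, ιMulti_zero_apply, contract_one]
        simp
      · rw [contract_ιMulti_succ]
        simp only [map_sum, map_smul, LinearMap.sum_apply, LinearMap.smul_apply]
        by_cases hmn : m = n
        · subst hmn
          rw [pairing_ιMulti, Matrix.det_succ_row_zero, Finset.mul_sum, Finset.mul_sum]
          refine Finset.sum_congr rfl fun j _ => ?_
          rw [pairing_ιMulti, pow_succ (2 : ℂ), smul_eq_mul]
          have h1 : (Matrix.of fun i j => f j (Matrix.vecCons v ξ i)).submatrix Fin.succ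
              j.succAbove = Matrix.of fun i k => j.removeNth f k (ξ i) := rfl
          rw [h1]
          simp only [Matrix.of_apply, Matrix.cons_val_zero, evalAt_apply]
          ring
        · rw [pairing_ιMulti_ne (by simpa using hmn)]
          simp [pairing_ιMulti_ne hmn]
    | h0 => simp
    | hadd y z hy hz => simp only [map_add, LinearMap.add_apply, hy, hz, mul_add]
    | hsmul c y hy => simp only [map_smul, LinearMap.smul_apply, hy, smul_eq_mul]; ring
  | h0 => simp
  | hadd X Y hX hY => simp only [mul_add, map_add, hX, hY]
  | hsmul c X hX => simp only [mul_smul_comm, map_smul, hX, smul_eq_mul]; ring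

variable [CompleteSpace L]

theorem ip_ι_toDual_mul (v : L) (x y : ExteriorAlgebra ℂ (StrongDual ℂ L)) :
    ip (ι ℂ (InnerProductSpace.toDual ℂ L v) * x) y = 2 * ip x (contract (evalAt v) y) := by
  rw [ip, extConj_mul, extConj_ι, rieszInv_toDual, pairing_ι_mul, ip]

theorem ip_parity_left (x y : ExteriorAlgebra ℂ (StrongDual ℂ L)) :
    ip (parity x) y = ip x (parity y) := by
  induction x using span_induction with
  | h n f =>
    induction y using span_induction with
    | h m g =>
      rw [parity_ιMulti, parity_ιMulti, ip_smul_left, ip_smul_right]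
      by_cases hmn : m = n
      · subst hmn; simp
      · rw [ip_ιMulti_ne (Ne.symm hmn), mul_zero, mul_zero]
    | h0 => simp [ip]
    | hadd y z hy hz => rw [ip_add_right, map_add, ip_add_right, hy, hz]
    | hsmul c y hy => rw [ip_smul_right, map_smul, ip_smul_right, hy]
  | h0 => simp [ip]
  | hadd x z hx hz => rw [map_add, ip_add_left, ip_add_left, hx, hz]
  | hsmul c x hx => rw [map_smul, ip_smul_left, ip_smul_left, hx]

end FockAlg

section Trace
variable {D N ι : Type*} [NormedAddCommGroup D] [InnerProductSpace ℂ D] [Fintype ι]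
  [AddCommGroup N] [Module ℂ N]

/-- Expanding `A e_a` in the first slot or `A' e_b` in the second gives the same double sum of
`⟪e_b, A e_a⟫ Φ(e_b, e_a)`. -/
theorem sum_apply_adjoint (e : OrthonormalBasis ι ℂ D) (Φ : D →ₗ[ℂ] D →ₛₗ[starRingEnd ℂ] N)
    {A A' : D →ₗ[ℂ] D} (h : ∀ x y, inner ℂ (A x) y = inner ℂ x (A' y)) :
    ∑ a, Φ (A (e a)) (e a) = ∑ a, Φ (e a) (A' (e a)) := by
  have h1 (a) : Φ (A (e a)) (e a) = ∑ b, inner ℂ (e b) (A (e a)) • Φ (e b) (e a) := by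
    conv_lhs => rw [← e.sum_repr' (A (e a))]
    simp
  have h2 (b) : Φ (e b) (A' (e b)) = ∑ a, inner ℂ (e b) (A (e a)) • Φ (e b) (e a) := by
    conv_lhs => rw [← e.sum_repr' (A' (e b))]
    simp only [map_sum, map_smulₛₗ]
    refine Finset.sum_congr rfl fun a _ => ?_
    rw [← h, inner_conj_symm]
  simp only [h1, h2]
  exact Finset.sum_comm
end Trace

/-! Operators on the Fock space of a finite-dimensional subspace -/

/-- The inner product of an `InnerProductSpace`. -/
local notation "⟪" x ", " y "⟫" => @inner ℂ _ InnerProductSpace.toInner x y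

namespace FockAlg
open ExteriorAlgebra
variable {L : Type*} [NormedAddCommGroup L] [InnerProductSpace ℂ L]

/-- Exterior multiplication by a linear form. -/
noncomputable def wedge (f : StrongDual ℂ L) : FockAlg L →ₗ[ℂ] FockAlg L :=
  (LinearMap.mulLeft ℂ (ι ℂ f) :
    ExteriorAlgebra ℂ (StrongDual ℂ L) →ₗ[ℂ] ExteriorAlgebra ℂ (StrongDual ℂ L))

/-- Twice the contraction with the evaluation at a vector. -/
noncomputable def annih (v : L) : FockAlg L →ₗ[ℂ] FockAlg L :=
  ((2 : ℂ) • contract (evalAt v) :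
    ExteriorAlgebra ℂ (StrongDual ℂ L) →ₗ[ℂ] ExteriorAlgebra ℂ (StrongDual ℂ L))

variable (L) in
/-- The parity operator. -/
noncomputable def par : FockAlg L →ₗ[ℂ] FockAlg L :=
  (parity.toLinearMap :
    ExteriorAlgebra ℂ (StrongDual ℂ L) →ₗ[ℂ] ExteriorAlgebra ℂ (StrongDual ℂ L))

theorem par_par (x : FockAlg L) : par L (par L x) = x := parity_parity x

theorem annih_ι_mul (v : L) (f : StrongDual ℂ L) (x : FockAlg L) :
    annih v (wedge f x) = (2 * f v) • x - wedge f (annih v x) := by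
  have h := congrArg (fun y => (2 : ℂ) • y) (contract_ι_mul (evalAt v) f x)
  exact h.trans ((smul_sub _ _ _).trans (congrArg₂ (· - ·) (smul_smul _ _ _)
    (mul_smul_comm (2 : ℂ) (ι ℂ f) (contract (evalAt v) x)).symm))

theorem par_wedge (f : StrongDual ℂ L) (x : FockAlg L) : par L (wedge f x) = -wedge f (par L x) := by
  refine (map_mul parity (ι ℂ f) x).trans ?_
  rw [parity_ι, neg_mul]
  rfl

variable [CompleteSpace L]

theorem inner_par_left (x y : FockAlg L) : ⟪par L x, y⟫ = ⟪x, par L y⟫ :=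
  ip_parity_left x y

variable [KreinSpace L]

/-- The adjoint is taken in the positive definite inner product, where `{v, ·}` is represented by
`sym v`. -/
theorem inner_wedge_left (v : L) (x y : FockAlg L) :
    ⟪wedge (kdual L v) x, y⟫ = ⟪x, annih (sym v) y⟫ := by
  refine (ip_ι_toDual_mul (sym v) x y).trans ?_
  exact (ip_smul_right _ _ _).symm

theorem gamma_wedge (v : L) (x : FockAlg L) :
    gamma L (wedge (kdual L v) x) = wedge (kdual L (sym v)) (gamma L x) := by
  have h : precompSym L (kdual L v) = kdual L (sym v) := by
    ext x
    simp [precompSym_apply, kdual_apply, kip, sym_sym]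
  refine (map_mul (ExteriorAlgebra.map (precompSym L)) (ι ℂ (kdual L v)) x).trans ?_
  rw [map_apply_ι, h]
  rfl

theorem gamma_par (x : FockAlg L) : gamma L (par L x) = par L (gamma L x) :=
  (parity_map (precompSym L) x).symm

theorem gamma_gamma (x : FockAlg L) : gamma L (gamma L x) = x := map_precompSym_twice x

theorem inner_gamma_left (x y : FockAlg L) : ⟪gamma L x, y⟫ = ⟪x, gamma L y⟫ := by
  rw [← (gamma L).inner_map_map (gamma L x) y, gamma_gamma]

end FockAlg

namespace FinSub
open ExteriorAlgebra FockAlg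
variable {L : Type*} [NormedAddCommGroup L] [InnerProductSpace ℂ L] [CompleteSpace L] [KreinSpace L]

theorem wedge_mem_fock {K : FinSub L} {v : L} (hv : v ∈ K.1) {x : FockAlg L} (hx : x ∈ K.fock) :
    wedge (kdual L v) x ∈ K.fock := by
  induction hx using Submodule.span_induction with
  | mem x h =>
    obtain ⟨n, ξ, hξ, rfl⟩ := h
    refine Submodule.subset_span ⟨n + 1, Matrix.vecCons v ξ, fun i => ?_, ?_⟩
    · cases i using Fin.cases with
      | zero => exact hv
      | succ i => exact hξ i
    · exact (ιMulti_succ_apply (fun i => kdual L (Matrix.vecCons v ξ i))).symm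
  | zero => rw [map_zero]; exact zero_mem _
  | add x y _ _ hx hy => rw [map_add]; exact add_mem hx hy
  | smul c x _ hx => rw [map_smul]; exact Submodule.smul_mem _ c hx

theorem cs_succ {n : ℕ} (ξ : Fin (n + 1) → L) :
    cs ξ = wedge (kdual L (ξ 0)) (cs (Matrix.vecTail ξ)) :=
  ιMulti_succ_apply fun i => kdual L (ξ i)

theorem cs_zero (ξ : Fin 0 → L) : cs ξ = 1 := ιMulti_zero_apply _

theorem fock_induction {K : FinSub L} {p : FockAlg L → Prop} (h1 : p 1)
    (hmul : ∀ v ∈ K.1, ∀ x ∈ K.fock, p x → p (wedge (kdual L v) x))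
    (h0 : p 0) (hadd : ∀ x y, p x → p y → p (x + y)) (hsmul : ∀ (c : ℂ) x, p x → p (c • x))
    {x : FockAlg L} (hx : x ∈ K.fock) : p x := by
  induction hx using Submodule.span_induction with
  | mem x h =>
    obtain ⟨n, ξ, hξ, rfl⟩ := h
    induction n with
    | zero => rw [cs_zero]; exact h1
    | succ n ih =>
      rw [cs_succ]
      exact hmul _ (hξ 0) _ (Submodule.subset_span ⟨n, _, fun i => hξ i.succ, rfl⟩)
        (ih _ fun i => hξ i.succ)
  | zero => exact h0
  | add x y _ _ hx hy => exact hadd x y hx hy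
  | smul c x _ hx => exact hsmul c x hx

theorem annih_mem_fock {K : FinSub L} (v : L) {x : FockAlg L} (hx : x ∈ K.fock) :
    annih v x ∈ K.fock := by
  refine fock_induction (p := fun x => annih v x ∈ K.fock) ?_ (fun w hw x hx ih => ?_) ?_
    (fun x y hx hy => ?_) (fun c x hx => ?_) hx
  · have : annih v (1 : FockAlg L) = 0 := by
      have h : (2 : ℂ) • contract (evalAt v) (1 : ExteriorAlgebra ℂ (StrongDual ℂ L)) = 0 := by
        rw [contract_one, smul_zero]
      exact h
    rw [this]; exact zero_mem _
  · rw [annih_ι_mul]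
    exact sub_mem (Submodule.smul_mem _ _ hx) (wedge_mem_fock hw ih)
  · rw [map_zero]; exact zero_mem _
  · rw [map_add]; exact add_mem hx hy
  · rw [map_smul]; exact Submodule.smul_mem _ c hx

theorem par_mem_fock {K : FinSub L} {x : FockAlg L} (hx : x ∈ K.fock) : par L x ∈ K.fock := by
  refine fock_induction (p := fun x => par L x ∈ K.fock) ?_ (fun w hw x hx ih => ?_) ?_
    (fun x y hx hy => ?_) (fun c x hx => ?_) hx
  · have : par L (1 : FockAlg L) = 1 := map_one parity
    rw [this]
    exact Submodule.subset_span ⟨0, Fin.elim0, fun i => i.elim0, (cs_zero _).symm⟩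
  · rw [par_wedge]
    exact neg_mem (wedge_mem_fock hw ih)
  · rw [map_zero]; exact zero_mem _
  · rw [map_add]; exact add_mem hx hy
  · rw [map_smul]; exact Submodule.smul_mem _ c hx

variable (K : FinSub L)

/-- The compression of `Γ` to `𝓕(K)`. -/
noncomputable def gammaC : K.fock →ₗ[ℂ] K.fock :=
  K.fock.orthogonalProjectionOnto.toLinearMap ∘ₗ (gamma L).toLinearMap ∘ₗ K.fock.subtype

theorem inner_gammaC (x y : K.fock) :
    ⟪x, K.gammaC y⟫ = ⟪(x : FockAlg L), gamma L y⟫ := by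
  exact Submodule.inner_orthogonalProjectionOnto_eq_of_mem_left x (gamma L y)

/-- `wedge` as an operator on `𝓕(K)`. -/
noncomputable def wedgeC {v : L} (hv : v ∈ K.1) : K.fock →ₗ[ℂ] K.fock :=
  (wedge (kdual L v)).restrict fun _ => wedge_mem_fock hv

/-- `annih` as an operator on `𝓕(K)`. -/
noncomputable def annihC (v : L) : K.fock →ₗ[ℂ] K.fock :=
  (annih v).restrict fun _ => annih_mem_fock v

/-- The parity operator on `𝓕(K)`. -/
noncomputable def parC : K.fock →ₗ[ℂ] K.fock :=
  (par L).restrict fun _ => par_mem_fock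

theorem inner_wedgeC {v : L} (hv : v ∈ K.1) (x y : K.fock) :
    ⟪K.wedgeC hv x, y⟫ = ⟪x, K.annihC (sym v) y⟫ :=
  inner_wedge_left v (x : FockAlg L) y

theorem inner_parC (x y : K.fock) : ⟪K.parC x, y⟫ = ⟪x, K.parC y⟫ :=
  inner_par_left (x : FockAlg L) y

/-- As `K` need not be stable under `sym`, `Γ` need not preserve `𝓕(K)` and only its compression is
available. Testing against `𝓕(K)` reduces the claim to `Γ` intertwining multiplication by `sym v`
with multiplication by `v`. Only the former has to preserve `𝓕(K)`. -/
theorem annihC_gammaC {v : L} (hv' : sym v ∈ K.1) (x : K.fock) :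
    K.annihC v (K.gammaC x) = K.gammaC (K.annihC (sym v) x) := by
  refine ext_inner_left ℂ fun y => ?_
  have h1 := inner_wedgeC K hv' y (K.gammaC x)
  rw [sym_sym] at h1
  rw [← h1, inner_gammaC, inner_gammaC, ← inner_gamma_left, ← inner_gamma_left]
  have h2 : gamma L (K.wedgeC hv' y : FockAlg L) = wedge (kdual L v) (gamma L y) := by
    have := gamma_wedge (sym v) (y : FockAlg L)
    rwa [sym_sym] at this
  rw [h2, inner_wedge_left]
  rfl

theorem gammaC_wedgeC {v : L} (hv : v ∈ K.1) (hv' : sym v ∈ K.1) (x : K.fock) :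
    K.gammaC (K.wedgeC hv' x) = K.wedgeC hv (K.gammaC x) := by
  refine ext_inner_left ℂ fun y => ?_
  have h2 : gamma L (K.wedgeC hv' x : FockAlg L) = wedge (kdual L v) (gamma L x) := by
    have := gamma_wedge (sym v) (x : FockAlg L)
    rwa [sym_sym] at this
  rw [inner_gammaC, h2, ← inner_conj_symm y, inner_wedgeC, inner_conj_symm, ← inner_conj_symm,
    inner_wedge_left, inner_conj_symm, inner_gammaC]
  rfl

theorem gammaC_parC (x : K.fock) : K.gammaC (K.parC x) = K.parC (K.gammaC x) := by
  refine ext_inner_left ℂ fun y => ?_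
  rw [inner_gammaC, ← inner_parC, inner_gammaC]
  change ⟪(y : FockAlg L), gamma L (par L x)⟫ = ⟪par L y, gamma L x⟫
  rw [gamma_par, inner_par_left]

theorem parC_parC (x : K.fock) : K.parC (K.parC x) = x := Subtype.ext (par_par _)

/-! ### The supertrace on `𝓕(K)` -/

section
variable {N : Type*} [AddCommGroup N] [Module ℂ N] (Φ : K.fock →ₗ[ℂ] K.fock →ₛₗ[starRingEnd ℂ] N)

/-- The supertrace of a sesquilinear map on `𝓕(K)`. -/
noncomputable def strace : N :=
  ∑ a, Φ (K.gammaC (stdOrthonormalBasis ℂ K.fock a)) (stdOrthonormalBasis ℂ K.fock a)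

/-- Commuting with the compressed `Γ` replaces `v` by `sym v`, and taking the adjoint replaces it
back. So the supertrace, unlike the plain trace, exchanges contraction and multiplication by the
same `v`. -/
theorem strace_annihC_left {v : L} (hv : v ∈ K.1) (hv' : sym v ∈ K.1) :
    K.strace (Φ ∘ₗ K.annihC v) = K.strace (Φ.compl₂ (K.wedgeC hv)) := by
  have := sum_apply_adjoint (stdOrthonormalBasis ℂ K.fock) (Φ ∘ₗ K.gammaC)
    (A := K.annihC (sym v)) (A' := K.wedgeC hv) fun x y => by
      rw [← inner_conj_symm, ← inner_wedgeC, inner_conj_symm]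
  simpa [strace, annihC_gammaC K hv'] using this

theorem strace_wedgeC_left {v : L} (hv : v ∈ K.1) (hv' : sym v ∈ K.1) :
    K.strace (Φ ∘ₗ K.wedgeC hv) = K.strace (Φ.compl₂ (K.annihC v)) := by
  have := sum_apply_adjoint (stdOrthonormalBasis ℂ K.fock) (Φ ∘ₗ K.gammaC)
    (A := K.wedgeC hv') (A' := K.annihC v) fun x y => by
      rw [inner_wedgeC, sym_sym]
  simpa [strace, gammaC_wedgeC K hv hv'] using this

/-- Parity is a self-adjoint involution commuting with the compressed `Γ`. This absorbs the signs
that arise when a one-form is moved past the first leg. -/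
theorem strace_parC : K.strace ((Φ ∘ₗ K.parC).compl₂ K.parC) = K.strace Φ := by
  have := sum_apply_adjoint (stdOrthonormalBasis ℂ K.fock) (Φ.compl₂ K.parC ∘ₗ K.gammaC)
    (A := K.parC) (A' := K.parC) (inner_parC K)
  simpa [strace, gammaC_parC, parC_parC] using this
end

/-! ### Regularized sums over ON-bases of the Fock space -/

section
variable {K}

theorem proj_mem (z : FockSpace L) : K.proj z ∈ K.fock := Submodule.coe_mem _

theorem inner_proj (x : K.fock) (z : FockSpace L) :
    ⟪(x : FockAlg L), K.proj z⟫ = ⟪((x : FockAlg L) : FockSpace L), z⟫ := by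
  rw [← UniformSpace.Completion.inner_coe, coe_proj, Submodule.starProjection_apply]
  exact Submodule.inner_orthogonalProjectionOnto_eq_of_mem_left
    (⟨_, Submodule.mem_map_of_mem x.2⟩ : K.fockImage) z

/-- The sign turns `ζ i` into `sym (ζ i)`. Expanding both projections in an orthonormal basis `e` of
`𝓕(K)` gives finitely many Parseval series, with sums `⟪sym e_c, e_a⟫`; these are the matrix
coefficients of the compressed `Γ`. -/
theorem hasSum_strace {I : Type*} {ζ : I → FockSpace L} (hζ : IsONBasis ζ)
    (Φ : FockAlg L →ₗ[ℂ] FockAlg L →ₛₗ[starRingEnd ℂ] ℂ) :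
    HasSum (fun i => (-1) ^ sig (ζ i) * Φ (K.proj (ζ i)) (K.proj (ζ i)))
      (K.strace ((Φ ∘ₗ K.fock.subtype).compl₂ K.fock.subtype)) := by
  set e := stdOrthonormalBasis ℂ K.fock with he
  let b := HilbertBasis.mk hζ.orthonormal (by
    rw [Submodule.dense_iff_topologicalClosure_eq_top.1 hζ.dense])
  have hb (i) : b i = ζ i := by simp [b]
  have hproj (z : FockSpace L) : K.proj z = ∑ a, (⟪((e a : FockAlg L) : FockSpace L), z⟫) •
      (e a : FockAlg L) := by
    have := congrArg K.fock.subtype (e.sum_repr' ⟨K.proj z, proj_mem z⟩)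
    rw [map_sum] at this
    refine this.symm.trans (Finset.sum_congr rfl fun a _ => ?_)
    rw [map_smul]
    congr 1
    exact inner_proj _ _
  have hsym (i) : (-1 : ℂ) ^ sig (ζ i) • ζ i = sym (ζ i) := by
    rw [sig]
    split_ifs with h
    · simp [mem_pos.1 h]
    · simp [mem_neg.1 ((hζ.mem i).resolve_left h)]
  have hself (x y : FockSpace L) : ⟪x, sym y⟫ = ⟪sym x, y⟫ := by
    rw [← (sym : FockSpace L →ₗᵢ[ℂ] FockSpace L).inner_map_map x, sym_sym]
  have hterm (i) : (-1) ^ sig (ζ i) * Φ (K.proj (ζ i)) (K.proj (ζ i)) = ∑ a, ∑ c,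
      (⟪(sym ((e c : FockAlg L) : FockSpace L)), b i⟫ *
        ⟪b i, ((e a : FockAlg L) : FockSpace L)⟫) * Φ (e c) (e a) := by
    rw [← smul_eq_mul, ← LinearMap.smul_apply, ← map_smul, ← map_smul, hsym, hproj, hproj (ζ i), hb]
    simp only [map_sum, map_smulₛₗ, LinearMap.sum_apply, LinearMap.smul_apply, smul_eq_mul, Finset.mul_sum, hself]
    exact Finset.sum_congr rfl fun a _ => Finset.sum_congr rfl fun c _ => by
      rw [inner_conj_symm]; simp; ring
  have hval : K.strace ((Φ ∘ₗ K.fock.subtype).compl₂ K.fock.subtype) = ∑ a, ∑ c,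
      ⟪(sym ((e c : FockAlg L) : FockSpace L)), ((e a : FockAlg L) : FockSpace L)⟫ *
        Φ (e c) (e a) := by
    rw [strace]
    refine Finset.sum_congr rfl fun a _ => ?_
    have h := congrArg K.fock.subtype (e.sum_repr' (K.gammaC (e a)))
    rw [LinearMap.compl₂_apply, LinearMap.comp_apply, ← he, ← h]
    simp only [map_sum, map_smul, LinearMap.sum_apply, LinearMap.smul_apply, smul_eq_mul]
    refine Finset.sum_congr rfl fun c _ => ?_
    rw [inner_gammaC, ← inner_gamma_left, ← UniformSpace.Completion.inner_coe,
      ← FockSpace.gamma_coe]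
    rfl
  simp only [hterm]
  rw [hval]
  refine hasSum_sum fun a _ => hasSum_sum fun c _ => ?_
  exact (b.hasSum_inner_mul_inner _ _).mul_right _
end

end FinSub

/-! Sewing two legs of a state -/

section Sew
open ExteriorAlgebra FockAlg
variable {L L' H : Type*} [NormedAddCommGroup L] [InnerProductSpace ℂ L]
  [NormedAddCommGroup L'] [InnerProductSpace ℂ L'] [NormedAddCommGroup H] [InnerProductSpace ℂ H]

theorem FockAlg.wedge_mul (f : StrongDual ℂ H) (x y : FockAlg H) :
    wedge f (x * y) = par H x * wedge f y := by
  have h (x y : ExteriorAlgebra ℂ (StrongDual ℂ H)) :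
      ι ℂ f * (x * y) = parity x * (ι ℂ f * y) := by
    rw [← mul_assoc, ι_mul_eq_parity_mul, mul_assoc]
  exact h x y

theorem FockAlg.annih_mul (v : H) (x y : FockAlg H) :
    annih v (x * y) = annih v x * y + par H x * annih v y := by
  have h (x y : ExteriorAlgebra ℂ (StrongDual ℂ H)) : (2 : ℂ) • contract (evalAt v) (x * y) =
      ((2 : ℂ) • contract (evalAt v) x) * y + parity x * ((2 : ℂ) • contract (evalAt v) y) := by
    rw [contract_mul, smul_add, smul_mul_assoc, mul_smul_comm]
  exact h x y

/-- The sesquilinear map `(x, y) ↦ F₁ x ∧ F₂ (b y)`, with the factors of the second form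
reversed. -/
noncomputable def sew (F₁ : StrongDual ℂ L →ₗ[ℂ] StrongDual ℂ H)
    (F₂ : StrongDual ℂ L' →ₗ[ℂ] StrongDual ℂ H)
    (b : StrongDual ℂ L →ₛₗ[starRingEnd ℂ] StrongDual ℂ L') :
    FockAlg L →ₗ[ℂ] FockAlg L →ₛₗ[starRingEnd ℂ] FockAlg H :=
  (LinearMap.mk₂'ₛₗ (RingHom.id ℂ) (starRingEnd ℂ)
    (fun x y => ExteriorAlgebra.map F₁ x *
      ExteriorAlgebra.map F₂ (CliffordAlgebra.reverse (extConj b y)))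
    (fun x x' y => by rw [map_add, add_mul])
    (fun c x y => by rw [map_smul, smul_mul_assoc]; rfl)
    (fun x y y' => by rw [map_add, map_add, map_add, mul_add])
    (fun c x y => by rw [map_smulₛₗ, map_smul, map_smul, mul_smul_comm]) :
    ExteriorAlgebra ℂ (StrongDual ℂ L) →ₗ[ℂ] ExteriorAlgebra ℂ (StrongDual ℂ L)
      →ₛₗ[starRingEnd ℂ] ExteriorAlgebra ℂ (StrongDual ℂ H))

variable (F₁ : StrongDual ℂ L →ₗ[ℂ] StrongDual ℂ H) (F₂ : StrongDual ℂ L' →ₗ[ℂ] StrongDual ℂ H)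
  (b : StrongDual ℂ L →ₛₗ[starRingEnd ℂ] StrongDual ℂ L')

theorem wedge_sew_left (f : StrongDual ℂ L) (x y : FockAlg L) :
    wedge (F₁ f) (sew F₁ F₂ b x y) = sew F₁ F₂ b (wedge f x) y := by
  have h (x : ExteriorAlgebra ℂ (StrongDual ℂ L)) (z : ExteriorAlgebra ℂ (StrongDual ℂ H)) :
      ι ℂ (F₁ f) * (ExteriorAlgebra.map F₁ x * z) = ExteriorAlgebra.map F₁ (ι ℂ f * x) * z := by
    rw [map_mul, map_apply_ι, mul_assoc]
  exact h x _

/-- Moving the one-form past both factors to the far right costs the parity of each. Since the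
second form is reversed, the far right is where a new first factor of `y` appears. -/
theorem wedge_sew_right (f : StrongDual ℂ L) (x y : FockAlg L) :
    wedge (F₂ (b f)) (sew F₁ F₂ b x y) = sew F₁ F₂ b (par L x) (wedge f (par L y)) := by
  have h (x y : ExteriorAlgebra ℂ (StrongDual ℂ L)) :
      ι ℂ (F₂ (b f)) * (ExteriorAlgebra.map F₁ x *
        ExteriorAlgebra.map F₂ (CliffordAlgebra.reverse (extConj b y))) =
      ExteriorAlgebra.map F₁ (parity x) *
        ExteriorAlgebra.map F₂ (CliffordAlgebra.reverse (extConj b (ι ℂ f * parity y))) := by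
    have hr (z : ExteriorAlgebra ℂ (StrongDual ℂ L')) : CliffordAlgebra.reverse (ι ℂ (b f) * z) =
        CliffordAlgebra.reverse z * ι ℂ (b f) := by
      rw [CliffordAlgebra.reverse.map_mul]; congr 1; exact CliffordAlgebra.reverse_ι _
    have hc (z : ExteriorAlgebra ℂ (StrongDual ℂ L')) :
        parity (CliffordAlgebra.reverse z) = CliffordAlgebra.reverse (parity z) :=
      (CliffordAlgebra.reverse_involute_commute
        (Q := (0 : QuadraticForm ℂ (StrongDual ℂ L')))).symm.eq z
    rw [← mul_assoc, ι_mul_eq_parity_mul, mul_assoc, ι_mul_eq_parity_mul, parity_map, parity_map,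
      hc, parity_extConj, extConj_mul, extConj_ι, hr, map_mul, map_apply_ι]
  exact h x y

/-- The hypotheses say that `ξ` restricts to `χ` on the first leg and to its conjugate on the
second, so contraction with `ξ` acts on either leg as contraction with `χ`. The minus sign is that
of `contract_reverse`. -/
theorem annih_sew {χ : L} {ξ : H} (h₁ : ∀ f, F₁ f ξ = f χ) (h₂ : ∀ f, F₂ (b f) ξ = conj (f χ))
    (x y : FockAlg L) : annih ξ (sew F₁ F₂ b x y) =
      sew F₁ F₂ b (annih χ x) y - sew F₁ F₂ b (par L x) (annih χ (par L y)) := by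
  have h (x y : ExteriorAlgebra ℂ (StrongDual ℂ L)) :
      contract (evalAt ξ) (ExteriorAlgebra.map F₁ x *
        ExteriorAlgebra.map F₂ (CliffordAlgebra.reverse (extConj b y))) =
      ExteriorAlgebra.map F₁ (contract (evalAt χ) x) *
        ExteriorAlgebra.map F₂ (CliffordAlgebra.reverse (extConj b y)) -
      ExteriorAlgebra.map F₁ (parity x) *
        ExteriorAlgebra.map F₂ (CliffordAlgebra.reverse
          (extConj b (contract (evalAt χ) (parity y)))) := by
    have e₁ : evalAt ξ ∘ₗ F₁ = evalAt χ := LinearMap.ext h₁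
    rw [contract_mul, contract_map, contract_map, e₁, contract_reverse, parity_map,
      parity_extConj, contract_extConj b (evalAt ξ ∘ₗ F₂) (evalAt χ), map_neg, mul_neg,
      sub_eq_add_neg]
    intro f
    change f χ = conj (F₂ (b f) ξ)
    rw [h₂, Complex.conj_conj]
  have e₁ (z : FockAlg L) : sew F₁ F₂ b (annih χ x) z = (2 : ℂ) • sew F₁ F₂ b
      (contract (evalAt χ) x : ExteriorAlgebra ℂ (StrongDual ℂ L)) z :=
    LinearMap.map_smul₂ (sew F₁ F₂ b) 2 _ _
  have e₂ (z : FockAlg L) (w : FockAlg L) : sew F₁ F₂ b z (annih χ w) = (2 : ℂ) • sew F₁ F₂ b z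
      (contract (evalAt χ) w : ExteriorAlgebra ℂ (StrongDual ℂ L)) := by
    refine (LinearMap.map_smulₛₗ (sew F₁ F₂ b z) 2 _).trans ?_
    rw [Complex.conj_ofNat]
  rw [e₁, e₂, ← smul_sub]
  exact congrArg (fun z : FockAlg H => (2 : ℂ) • z) (h x y)

variable [CompleteSpace L] [KreinSpace L]

/-- The sum of `sew (P Γ e) e` over an orthonormal basis of `𝓕(K)`. -/
noncomputable def sewPair (K : FinSub L) : FockAlg H :=
  K.strace ((sew F₁ F₂ b ∘ₗ K.fock.subtype).compl₂ K.fock.subtype)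

theorem FinSub.map_strace {N N' : Type*} [AddCommGroup N] [Module ℂ N] [AddCommGroup N']
    [Module ℂ N'] (K : FinSub L) (Φ : K.fock →ₗ[ℂ] K.fock →ₛₗ[starRingEnd ℂ] N) (A : N →ₗ[ℂ] N') :
    A (K.strace Φ) = K.strace (Φ.compr₂ₛₗ A) := by
  simp [FinSub.strace]

/-- Under the supertrace, multiplication on one leg equals contraction on the other. The two
multiplications on the left are therefore, crosswise, the two contractions making up `annih ξ`. -/
theorem wedge_sewPair (K : FinSub L) {χ : L} (hχ : χ ∈ K.1) (hχ' : sym χ ∈ K.1) {ξ : H}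
    (h₁ : ∀ f, F₁ f ξ = f χ) (h₂ : ∀ f, F₂ (b f) ξ = conj (f χ)) :
    wedge (F₁ (kdual L χ) - F₂ (b (kdual L χ))) (sewPair F₁ F₂ b K) =
      -annih ξ (sewPair F₁ F₂ b K) := by
  set Φ := (sew F₁ F₂ b ∘ₗ K.fock.subtype).compl₂ K.fock.subtype with hΦ
  have hP : sewPair F₁ F₂ b K = K.strace Φ := rfl
  have e₁ : wedge (F₁ (kdual L χ)) (K.strace Φ) = K.strace (Φ ∘ₗ K.wedgeC hχ) := by
    rw [K.map_strace]
    exact Finset.sum_congr rfl fun a _ => wedge_sew_left F₁ F₂ b _ _ _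
  have e₂ : wedge (F₂ (b (kdual L χ))) (K.strace Φ) = K.strace (Φ.compl₂ (K.wedgeC hχ)) := by
    rw [K.map_strace, ← K.strace_parC (Φ.compl₂ (K.wedgeC hχ))]
    exact Finset.sum_congr rfl fun a _ => wedge_sew_right F₁ F₂ b _ _ _
  have e₃ : annih ξ (K.strace Φ) = K.strace (Φ ∘ₗ K.annihC χ) -
      K.strace (Φ.compl₂ (K.annihC χ)) := by
    rw [K.map_strace, ← K.strace_parC (Φ.compl₂ (K.annihC χ)), FinSub.strace, FinSub.strace,
      FinSub.strace, ← Finset.sum_sub_distrib]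
    exact Finset.sum_congr rfl fun a _ => annih_sew F₁ F₂ b h₁ h₂ _ _
  have hw (f g : StrongDual ℂ H) (x : FockAlg H) : wedge (f - g) x = wedge f x - wedge g x := by
    have h (x : ExteriorAlgebra ℂ (StrongDual ℂ H)) : ι ℂ (f - g) * x = ι ℂ f * x - ι ℂ g * x := by
      rw [map_sub, sub_mul]
    exact h x
  rw [hP, hw, e₁, e₂, e₃, K.strace_annihC_left Φ hχ hχ', K.strace_wedgeC_left Φ hχ hχ', neg_sub]

end Sew

/-! ### Functionals obeying a Wick rule -/

section
open ExteriorAlgebra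
variable {W : Type*} [AddCommGroup W] [Module ℂ W]

/-- The functional `R` satisfies the Wick rule for exterior multiplication by `f`. -/
def SatisfiesWick (B : W →ₗ[ℂ] W →ₗ[ℂ] ℂ) (R : ExteriorAlgebra ℂ W →ₗ[ℂ] ℂ) (f : W) : Prop :=
  ∀ x, R (ι ℂ f * x) = 2 * R (contract (B f) x)

variable {B : W →ₗ[ℂ] W →ₗ[ℂ] ℂ} {R : ExteriorAlgebra ℂ W →ₗ[ℂ] ℂ}

theorem SatisfiesWick.add_smul {f g : W} (hf : SatisfiesWick B R f) (hg : SatisfiesWick B R g)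
    (c : ℂ) : SatisfiesWick B R (f + c • g) := fun x => by
  have hc : contract (B (f + c • g)) x = contract (B f) x + c • contract (B g) x := by
    simp [contract]
  rw [hc, map_add, map_smul, add_mul, smul_mul_assoc, map_add, map_smul, hf x, hg x, map_add,
    map_smul, smul_eq_mul, smul_eq_mul]
  ring

/-- A functional satisfying the Wick rule is determined by its value on the vacuum. -/
theorem SatisfiesWick.apply_ιMulti (hB : ∀ v, B v v = 0) {n : ℕ} {f : Fin n → W}
    (hf : ∀ i, SatisfiesWick B R (f i)) :
    R (ιMulti ℂ n f) = wick hB (ιMulti ℂ n f) * R 1 := by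
  -- The recursion only ever pulls out members of the family `f`, so the rule is needed for these
  -- finitely many one-forms and no others.
  induction n using Nat.twoStepInduction with
  | zero => rw [ιMulti_zero_apply, wick_one, one_mul]
  | one =>
    rw [ιMulti_succ_apply, hf 0, wick_ι_mul, ιMulti_zero_apply, contract_one, map_zero, map_zero]
    ring
  | more k ih _ =>
    rw [wick_ιMulti_add_two, ιMulti_succ_apply, hf 0, contract_ιMulti_succ, map_sum, mul_assoc,
      Finset.sum_mul]
    congr 1
    refine Finset.sum_congr rfl fun i _ => ?_
    rw [map_smul, smul_eq_mul, ih (f := i.removeNth (Matrix.vecTail f)) fun j => hf _, ← mul_assoc]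
    rfl
end

/-! ### Conjugations and the indefinite inner product -/

namespace KreinSpace
variable {V : Type*} [NormedAddCommGroup V] [InnerProductSpace ℂ V] [KreinSpace V]

theorem conj_kip (x y : V) : conj (kip x y) = kip y x := by
  rw [kip, kip, inner_conj_symm, ← (sym : V →ₗᵢ[ℂ] V).inner_map_map, sym_sym]

theorem kip_smul_right (c : ℂ) (x y : V) : kip x (c • y) = c * kip x y := inner_smul_right _ _ _

/-- The anti-isometry is assumed for real parts only. Applied to `x` and `i y`, it gives the
imaginary part, by conjugate linearity of `u`. -/
theorem IsConjugation.kip_map_map {W : Submodule ℝ V} {u : V →ₛₗ[starRingEnd ℂ] V}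
    (h : IsConjugation W u) (x y : V) : kip (u x) (u y) = -conj (kip x y) := by
  refine Complex.ext ?_ ?_
  · simpa using h.anti x y
  · have := h.anti x (Complex.I • y)
    rw [map_smulₛₗ, kip_smul_right, kip_smul_right] at this
    simpa using this

/-- This antisymmetry is what makes the form in the amplitude alternating. -/
theorem IsConjugation.kip_map_right {W : Submodule ℝ V} {u : V →ₛₗ[starRingEnd ℂ] V}
    (h : IsConjugation W u) (x y : V) : kip x (u y) = -kip y (u x) := by
  have := h.kip_map_map (u x) y
  rw [h.involutive] at this
  rw [this, conj_kip]

end KreinSpace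

/-! ### The amplitude as a Wick functional -/

namespace ClassicalTheory
open ExteriorAlgebra FockAlg
variable {X : SpacetimeSystem.{u, v}} (T : ClassicalTheory.{u, v, w} X)

theorem ampBil_self (M : X.Region) (f : StrongDual ℂ (T.L (X.bd M))) : T.ampBil M f f = 0 := by
  have h := (T.conjugation_spec M).kip_map_right (kdualInv _ f) (kdualInv _ f)
  have e : T.ampBil M f f = kip (kdualInv _ f) (T.conjugation M (kdualInv _ f)) := by
    rw [← kdual_apply, kdual_kdualInv]
    rfl
  rw [e]
  exact self_eq_neg.1 h

theorem amp_eq_wick (M : X.Region) (x : ExteriorAlgebra ℂ (StrongDual ℂ (T.L (X.bd M)))) :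
    T.amp M x = wick (T.ampBil_self M) x := by
  induction x using induction_ιMulti with
  | h n f =>
    by_cases hn : Even n
    · rw [wick_ιMulti_even _ hn]
      have := T.amp_cs_even M hn fun i => kdualInv _ (f i)
      simp only [cs, kdual_kdualInv] at this
      exact this
    · rw [wick_ιMulti_odd _ hn]
      have := T.amp_cs_odd M hn fun i => kdualInv _ (f i)
      simp only [cs, kdual_kdualInv] at this
      exact this
  | h0 => rw [map_zero]; exact map_zero (T.amp M)
  | hadd x y hx hy => rw [map_add, ← hx, ← hy]; exact map_add (T.amp M) x y
  | hsmul c x hx => rw [map_smul, ← hx]; exact map_smul (T.amp M) c x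

/-- Since `u` fixes `ξ`, antisymmetry turns `{ξ, u η}` into `-{η, ξ}`. -/
theorem ampBil_kdual_of_mem {M : X.Region} {ξ : T.L (X.bd M)} (hξ : ξ ∈ T.bdSol M) :
    T.ampBil M (kdual _ ξ) = -evalAt ξ := by
  ext f
  have h := (T.conjugation_spec M).kip_map_right ξ (kdualInv _ f)
  rw [((T.conjugation_spec M).mem_iff ξ).1 hξ] at h
  rw [LinearMap.neg_apply, evalAt_apply, ← kdual_kdualInv f, kdual_apply, ← h, ← kdual_apply,
    kdual_kdualInv]
  rfl

/-- The Wick rule freed of the conjugation. The conjugations of `M` and `M₁` are not directly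
related, but their solutions are, so this is the form that can be transported through the gluing. -/
theorem amp_wedge_kdual {M : X.Region} {ξ : T.L (X.bd M)} (hξ : ξ ∈ T.bdSol M)
    (x : FockAlg (T.L (X.bd M))) : T.amp M (wedge (kdual _ ξ) x) = -T.amp M (annih ξ x) := by
  have h (x : ExteriorAlgebra ℂ (StrongDual ℂ (T.L (X.bd M)))) :
      wick (T.ampBil_self M) (ι ℂ (kdual _ ξ) * x) =
        -wick (T.ampBil_self M) ((2 : ℂ) • contract (evalAt ξ) x) := by
    rw [wick_ι_mul, T.ampBil_kdual_of_mem hξ]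
    simp [contract]
  exact (T.amp_eq_wick M _).trans ((h x).trans (congrArg Neg.neg (T.amp_eq_wick M _).symm))

/-! ### The free leg and the two glued legs of `∂M` -/

variable {M M₁ : X.Region} {S : X.Hyp} (g : X.Gluing M M₁ S)

section Legs
variable {S₁ S₂ S₃ S₀ : X.Hyp} (δ : X.Decomposition ![S₁, S₂, S₃] S₀)

/-- The projection to the first hypersurface of a decomposition. -/
noncomputable def leg₀ (y : T.L S₀) : T.L S₁ := (T.iso δ).symm y 0

/-- The projection to the second hypersurface of a decomposition. -/
noncomputable def leg₁ (y : T.L S₀) : T.L S₂ := (T.iso δ).symm y 1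

/-- The projection to the third hypersurface of a decomposition. -/
noncomputable def leg₂ (y : T.L S₀) : T.L S₃ := (T.iso δ).symm y 2

theorem kip_legs (x y : T.L S₀) : kip x y = kip (T.leg₀ δ x) (T.leg₀ δ y) +
    kip (T.leg₁ δ x) (T.leg₁ δ y) + kip (T.leg₂ δ x) (T.leg₂ δ y) := by
  have h := T.kip_iso δ ((T.iso δ).symm x) ((T.iso δ).symm y)
  rw [ContinuousLinearEquiv.apply_symm_apply, ContinuousLinearEquiv.apply_symm_apply] at h
  exact h.trans (Fin.sum_univ_three _)
end Legs

theorem barDual_apply_bar (f : StrongDual ℂ (T.L S)) (x : T.L S) :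
    T.barDual S f (T.bar S x) = conj (f x) :=
  congrArg (fun z => conj (f z)) ((T.bar S).symm_apply_apply x)

/-- The sign is that of `kip_bar`. It turns the sum of the two glued components of `{ξ, ·}` into the
difference required by `wedge_sewPair`. -/
theorem barDual_kdual (x : T.L S) : T.barDual S (kdual _ x) = -kdual _ (T.bar S x) := by
  ext y
  obtain ⟨y, rfl⟩ := (T.bar S).surjective y
  rw [barDual_apply_bar, neg_apply, kdual_apply, kdual_apply, T.kip_bar, neg_neg]

theorem bar_leg₁_glue (x : T.LReg M₁) : T.bar S (T.leg₁ (X.gluingBd g) (T.r M (T.glue g x))) =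
    T.leg₂ (X.gluingBd g) (T.r M (T.glue g x)) :=
  (T.glue_exact g (T.glue g x)).1 ⟨x, rfl⟩

theorem leg₀_glue (x : T.LReg M₁) :
    T.leg₀ (X.gluingBd g) (T.r M (T.glue g x)) = T.r M₁ x :=
  T.r_glue g x

/-- The pullback of linear forms to `∂M` along the projection to `∂M₁`. -/
noncomputable def pull₀ : StrongDual ℂ (T.L (X.bd M₁)) →ₗ[ℂ] StrongDual ℂ (T.L (X.bd M)) :=
  T.pullDual (X.gluingBd g) 0

/-- The pullback of linear forms to `∂M` along the projection to `S`. -/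
noncomputable def pull₁ : StrongDual ℂ (T.L S) →ₗ[ℂ] StrongDual ℂ (T.L (X.bd M)) :=
  T.pullDual (X.gluingBd g) 1

/-- The pullback of linear forms to `∂M` along the projection to the reversed copy of `S`. -/
noncomputable def pull₂ : StrongDual ℂ (T.L (X.rev S)) →ₗ[ℂ] StrongDual ℂ (T.L (X.bd M)) :=
  T.pullDual (X.gluingBd g) 2

theorem pull₀_apply (f : StrongDual ℂ (T.L (X.bd M₁))) (y : T.L (X.bd M)) :
    T.pull₀ g f y = f (T.leg₀ (X.gluingBd g) y) := rfl

theorem pull₁_apply (f : StrongDual ℂ (T.L S)) (y : T.L (X.bd M)) :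
    T.pull₁ g f y = f (T.leg₁ (X.gluingBd g) y) := rfl

theorem pull₂_apply (f : StrongDual ℂ (T.L (X.rev S))) (y : T.L (X.bd M)) :
    T.pull₂ g f y = f (T.leg₂ (X.gluingBd g) y) := rfl

/-- The sesquilinear map `(x, y) ↦ τ(1 ⊗ x ⊗ ι y)`. -/
noncomputable def glueForm : FockAlg (T.L S) →ₗ[ℂ] FockAlg (T.L S) →ₛₗ[starRingEnd ℂ]
    FockAlg (T.L (X.bd M)) :=
  sew (T.pull₁ g) (T.pull₂ g) (T.barDual S)

/-- The regularized copairing of the two glued hypersurfaces. -/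
noncomputable def gluePair (K : FinSub (T.L S)) : FockAlg (T.L (X.bd M)) :=
  sewPair (T.pull₁ g) (T.pull₂ g) (T.barDual S) K

/-- The pullback of states to `∂M` along the projection to `∂M₁`. -/
noncomputable def glueBase : FockAlg (T.L (X.bd M₁)) →ₐ[ℂ] FockAlg (T.L (X.bd M)) :=
  T.pull (X.gluingBd g) 0

/-- By associativity `τ(ψ ⊗ x ⊗ ι y)` is the pullback of `ψ` times `τ(1 ⊗ x ⊗ ι y)`. The summand is
thus a sesquilinear form in `P_K ζ`, and the linear functional comes out of the supertrace. -/
theorem hasSum_glueTerm (K : FinSub (T.L S)) (ψ : FockAlg (T.L (X.bd M₁))) {I : Type*}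
    {ζ : I → FockSpace (T.L S)} (hζ : IsONBasis ζ) :
    HasSum (fun i => T.glueTerm g K ψ (ζ i)) (T.amp M (T.glueBase g ψ * T.gluePair g K)) := by
  let A : FockAlg (T.L (X.bd M)) →ₗ[ℂ] ℂ :=
    T.amp M ∘ₗ LinearMap.mulLeft ℂ (T.glueBase g ψ)
  have h := FinSub.hasSum_strace (K := K) hζ ((T.glueForm g).compr₂ₛₗ A)
  have e := FinSub.map_strace K ((T.glueForm g ∘ₗ K.fock.subtype).compl₂ K.fock.subtype) A
  have hterm (i) : T.glueTerm g K ψ (ζ i) =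
      (-1) ^ sig (ζ i) * (T.glueForm g).compr₂ₛₗ A (K.proj (ζ i)) (K.proj (ζ i)) :=
    congrArg (fun z => (-1) ^ sig (ζ i) * T.amp M z) (mul_assoc _ _ _)
  simp only [hterm]
  exact e ▸ h

theorem kdual_glue (x : T.LReg M₁) :
    kdual _ (T.r M (T.glue g x)) = T.pull₀ g (kdual _ (T.r M₁ x)) +
      (T.pull₁ g (kdual _ (T.leg₁ (X.gluingBd g) (T.r M (T.glue g x)))) -
        T.pull₂ g (T.barDual S (kdual _ (T.leg₁ (X.gluingBd g) (T.r M (T.glue g x)))))) := by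
  ext y
  rw [kdual_apply, T.kip_legs (X.gluingBd g), leg₀_glue, barDual_kdual, bar_leg₁_glue, map_neg,
    sub_neg_eq_add]
  simp only [add_apply, pull₀_apply, pull₁_apply, pull₂_apply, kdual_apply]
  ring

/-- Complete the one-form of `r x` to that of the glued solution `ξ` and use the identity of `ρ_M`
for `ξ`. The correction term on the glued legs cancels the part of the contraction that hits the
copairing. -/
theorem amp_glueBase_wedge (x : T.LReg M₁) :
    ∀ᶠ K in (atTop : Filter (FinSub (T.L S))), ∀ ψ : FockAlg (T.L (X.bd M₁)),
      T.amp M (T.glueBase g (wedge (kdual _ (T.r M₁ x)) ψ) * T.gluePair g K) =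
        -T.amp M (T.glueBase g (annih (T.r M₁ x) ψ) * T.gluePair g K) := by
  obtain ⟨χ, hχ⟩ : ∃ χ : T.L S, χ = T.leg₁ (X.gluingBd g) (T.r M (T.glue g x)) := ⟨_, rfl⟩
  -- Both `χ` and `sym χ` are needed to commute multiplication past the compressed `Γ`. The
  -- threshold depends on `x` only, so it serves all `ψ` at once.
  have hle := eventually_ge_atTop (⟨Submodule.span ℂ {χ, sym χ},
    FiniteDimensional.span_of_finite ℂ (Set.toFinite _)⟩ : FinSub (T.L S))
  filter_upwards [hle] with K hK ψ
  have hK : Submodule.span ℂ {χ, sym χ} ≤ K.1 := hK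
  have hχ₁ : χ ∈ K.1 := hK (Submodule.subset_span (by simp))
  have hχ₂ : sym χ ∈ K.1 := hK (Submodule.subset_span (by simp))
  set ξ := T.r M (T.glue g x) with hξ
  have hξ' : ξ ∈ T.bdSol M := ⟨_, rfl⟩
  have h₁ (f : StrongDual ℂ (T.L S)) : T.pull₁ g f ξ = f χ := by rw [pull₁_apply, hχ]
  have h₂ (f : StrongDual ℂ (T.L S)) : T.pull₂ g (T.barDual S f) ξ = conj (f χ) := by
    rw [pull₂_apply, hξ, ← bar_leg₁_glue, barDual_apply_bar, hχ]
  have hΘ : wedge (T.pull₁ g (kdual _ χ) - T.pull₂ g (T.barDual S (kdual _ χ)))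
      (T.gluePair g K) = -annih ξ (T.gluePair g K) :=
    wedge_sewPair _ _ _ K hχ₁ hχ₂ h₁ h₂
  have hbase : T.glueBase g (wedge (kdual _ (T.r M₁ x)) ψ) =
      wedge (T.pull₀ g (kdual _ (T.r M₁ x))) (T.glueBase g ψ) := by
    refine (map_mul (T.glueBase g) _ _).trans ?_
    exact congrArg (· * T.glueBase g ψ) (ExteriorAlgebra.map_apply_ι (T.pull₀ g) _)
  have hannih : annih ξ (T.glueBase g ψ) = T.glueBase g (annih (T.r M₁ x) ψ) := by
    have e : evalAt ξ ∘ₗ T.pull₀ g = evalAt (T.r M₁ x) := by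
      ext f
      rw [LinearMap.comp_apply, evalAt_apply, pull₀_apply, hξ, leg₀_glue, evalAt_apply]
    have h (ψ : ExteriorAlgebra ℂ (StrongDual ℂ (T.L (X.bd M₁)))) :
        (2 : ℂ) • contract (evalAt ξ) (ExteriorAlgebra.map (T.pull₀ g) ψ) =
        ExteriorAlgebra.map (T.pull₀ g) ((2 : ℂ) • contract (evalAt (T.r M₁ x)) ψ) := by
      rw [contract_map, e, map_smul]
    exact h ψ
  have hw (f g : StrongDual ℂ (T.L (X.bd M))) (y z : FockAlg (T.L (X.bd M))) :
      wedge f y * z = wedge (f + g) (y * z) - wedge g (y * z) := by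
    have h (y z : ExteriorAlgebra ℂ (StrongDual ℂ (T.L (X.bd M)))) :
        ι ℂ f * y * z = ι ℂ (f + g) * (y * z) - ι ℂ g * (y * z) := by
      rw [map_add, add_mul, add_sub_cancel_right, mul_assoc]
    exact h y z
  -- Both `wedge_mul` and `annih_mul` put the parity of the base factor in front of the copairing,
  -- so the two terms produced there have opposite signs and cancel.
  rw [hbase, hw _ (T.pull₁ g (kdual _ χ) - T.pull₂ g (T.barDual S (kdual _ χ))), hχ,
    ← T.kdual_glue g x, ← hξ, ← hχ, map_sub, T.amp_wedge_kdual hξ', annih_mul, wedge_mul, hΘ,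
    hannih, map_add, mul_neg, map_neg]
  ring

theorem eventually_satisfiesWick (f : StrongDual ℂ (T.L (X.bd M₁))) :
    ∀ᶠ K in (atTop : Filter (FinSub (T.L S))), SatisfiesWick (T.ampBil M₁)
      (T.amp M ∘ₗ LinearMap.mulRight ℂ (T.gluePair g K) ∘ₗ (T.glueBase g).toLinearMap) f := by
  obtain ⟨_, ⟨x, rfl⟩, _, ⟨y, rfl⟩, h⟩ := T.exists_decomp M₁ (kdualInv _ f)
  -- The coefficient is conjugated because `kdual` is conjugate linear; the Wick rule itself is
  -- complex linear in the one-form.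
  have hf : f = kdual _ (T.r M₁ x) + conj Complex.I • kdual _ (T.r M₁ y) := by
    rw [← map_smulₛₗ, ← map_add, ← h, kdual_kdualInv]
  have key (x : T.LReg M₁) : ∀ᶠ K in (atTop : Filter (FinSub (T.L S))),
      SatisfiesWick (T.ampBil M₁) (T.amp M ∘ₗ LinearMap.mulRight ℂ (T.gluePair g K) ∘ₗ
        (T.glueBase g).toLinearMap) (kdual _ (T.r M₁ x)) := by
    filter_upwards [T.amp_glueBase_wedge g x] with K hK ψ
    refine (hK ψ).trans ?_
    rw [T.ampBil_kdual_of_mem ⟨x, rfl⟩]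
    set R : FockAlg (T.L (X.bd M₁)) →ₗ[ℂ] ℂ :=
      T.amp M ∘ₗ LinearMap.mulRight ℂ (T.gluePair g K) ∘ₗ (T.glueBase g).toLinearMap
    have h (R : ExteriorAlgebra ℂ (StrongDual ℂ (T.L (X.bd M₁))) →ₗ[ℂ] ℂ) :
        -R ((2 : ℂ) • contract (evalAt (T.r M₁ x)) ψ) =
          2 * R (contract (-evalAt (T.r M₁ x)) ψ) := by
      simp [contract]
    exact h R
  filter_upwards [key x, key y] with K hx hy
  rw [hf]
  exact hx.add_smul hy _

theorem eventually_glue (ψ : FockAlg (T.L (X.bd M₁))) :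
    ∀ᶠ K in (atTop : Filter (FinSub (T.L S))),
      T.amp M (T.glueBase g ψ * T.gluePair g K) = T.amp M₁ ψ * T.amp M (T.gluePair g K) := by
  refine span_induction (p := fun ψ => ∀ᶠ K in (atTop : Filter (FinSub (T.L S))),
      T.amp M (T.glueBase g ψ * T.gluePair g K) = T.amp M₁ ψ * T.amp M (T.gluePair g K))
    (fun n f => ?_) ?_ (fun x y hx hy => ?_) (fun c x hx => ?_) ψ
  -- A generator has finitely many factors, so their thresholds have a common upper bound.
  · filter_upwards [eventually_all.2 fun i => T.eventually_satisfiesWick g (f i)] with K hK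
    have h := SatisfiesWick.apply_ιMulti (T.ampBil_self M₁) hK
    rw [← T.amp_eq_wick] at h
    refine h.trans (congrArg (fun z => _ * T.amp M z) ?_)
    refine (congrArg (· * T.gluePair g K) (map_one (T.glueBase g))).trans (one_mul _)
  · refine Eventually.of_forall fun K => ?_
    have h1 : T.glueBase g (0 : FockAlg (T.L (X.bd M₁))) = 0 := map_zero _
    have h2 : T.amp M₁ (0 : FockAlg (T.L (X.bd M₁))) = 0 := map_zero _
    exact (congrArg (fun z => T.amp M (z * T.gluePair g K)) h1).trans
      (by rw [zero_mul, map_zero]; exact ((congrArg (· * _) h2).trans (zero_mul _)).symm)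
  · filter_upwards [hx, hy] with K hx hy
    have h (x y : FockAlg (T.L (X.bd M₁)))
        (hx : T.amp M (T.glueBase g x * T.gluePair g K) = T.amp M₁ x * T.amp M (T.gluePair g K))
        (hy : T.amp M (T.glueBase g y * T.gluePair g K) = T.amp M₁ y * T.amp M (T.gluePair g K)) :
        T.amp M (T.glueBase g (x + y) * T.gluePair g K) =
          T.amp M₁ (x + y) * T.amp M (T.gluePair g K) := by
      rw [map_add, add_mul, map_add, hx, hy, map_add, add_mul]
    exact h x y hx hy
  · filter_upwards [hx] with K hx
    have h (x : FockAlg (T.L (X.bd M₁)))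
        (hx : T.amp M (T.glueBase g x * T.gluePair g K) = T.amp M₁ x * T.amp M (T.gluePair g K)) :
        T.amp M (T.glueBase g (c • x) * T.gluePair g K) =
          T.amp M₁ (c • x) * T.amp M (T.gluePair g K) := by
      rw [map_smul, smul_mul_assoc, map_smul, hx, map_smul, smul_mul_assoc]
    exact h x hx

end ClassicalTheory

end Gluing

/-! ### The renormalized gluing identity -/

theorem mainTheorem2 {X : SpacetimeSystem.{u, v}} (T : ClassicalTheory.{u, v, w} X)
    {M M₁ : X.Region} {S : X.Hyp} (g : X.Gluing M M₁ S) :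
    ∃ c : FinSub (T.L S) → ℂ,
      (∀ (α : FinSub (T.L S)) {I : Type z} (ζ : I → FockSpace (T.L S)), KreinSpace.IsONBasis ζ →
        HasSum (fun i => T.glueTerm g α 1 (ζ i)) (c α)) ∧
      ∀ ψ : FockAlg (T.L (X.bd M₁)),
        (∀ (α : FinSub (T.L S)) {I : Type z} (ζ : I → FockSpace (T.L S)), KreinSpace.IsONBasis ζ →
          Summable fun i => T.glueTerm g α ψ (ζ i)) ∧
        (∀ {I : Type z} (ζ : I → FockSpace (T.L S)), KreinSpace.IsONBasis ζ →
          Tendsto (fun α => T.amp M₁ ψ * c α - ∑' i, T.glueTerm g α ψ (ζ i)) atTop (𝓝 0)) ∧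
        ∃ β : FinSub (T.L S), ∀ γ ≥ β, ∀ {I : Type z} (ζ : I → FockSpace (T.L S)),
          KreinSpace.IsONBasis ζ → T.amp M₁ ψ * c γ - ∑' i, T.glueTerm g γ ψ (ζ i) = 0 := by
  -- The value is fixed before any ON-basis is chosen, which is the basis independence; `HasSum` in
  -- `ℂ` is absolute convergence.
  refine ⟨fun K => T.amp M (T.gluePair g K), fun K I ζ hζ => ?_, fun ψ => ?_⟩
  · have := T.hasSum_glueTerm g K 1 hζ
    rwa [map_one, one_mul] at this
  · have h := T.eventually_glue g ψ
    refine ⟨fun K I ζ hζ => (T.hasSum_glueTerm g K ψ hζ).summable, fun ζ hζ => ?_, ?_⟩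
    · refine tendsto_const_nhds.congr' ?_
      filter_upwards [h] with K hK
      rw [(T.hasSum_glueTerm g K ψ hζ).tsum_eq, hK, sub_self]
    · obtain ⟨β, hβ⟩ := eventually_atTop.1 h
      refine ⟨β, fun K hK I ζ hζ => ?_⟩
      rw [(T.hasSum_glueTerm g K ψ hζ).tsum_eq, hβ K hK, sub_self]
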